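/- **Setting.** Let $\mathcal{A}=(L_1,\dots,L_n)$ be an (ordered) arrangement of $n$ distinct lines in $\mathbb{CP}^2$. The multiplicity of a point $p\in\mathbb{CP}^2$ is the number of lines $L_i$ through $p$; $n_r$ denotes the number of points of multiplicity exactly $r$; a *multiple point* is a point of multiplicity at least $3$. The arrangement $\mathcal{A}$ is *non-reductive* if each line of $\mathcal{A}$ passes through at least $3$ multiple points. For $\mathcal{B}=(H_1,\dots,H_n)\in((\mathbb{CP}^2)^*)^n$ write $L(\mathcal{B})=L(\mathcal{A})$ if $\dim\bigcap_{i\in S}H_i=\dim\bigcap_{i\in S}L_i$ for every nonempty $S\subseteq\{1,\dots,n\}$. The moduli space of $\mathcal{A}$ is $$\mathcal{M}_{\mathcal{A}}=\{\mathcal{B}\in((\mathbb{CP}^2)^*)^n \mid L(\mathcal{B})=L(\mathcal{A})\}/PGL(3,\mathbb{C}),$$ with the quotient of the Zariski topology, and $\mathcal{M}^c_{\mathcal{A}}$ is the quotient of $\mathcal{M}_{\mathcal{A}}$ by complex conjugation. **Theorem.** Let $\mathcal{A}$ be a non-reductive arrangement of $10$ lines in $\mathbb{CP}^2$ such that $n_4=3$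 and $n_r=0$ for all $r\geq 5$. Then $\mathcal{M}_{\mathcal{A}}$ or $\mathcal{M}^c_{\mathcal{A}}$ is irreducible. -/

import Mathlib

open scoped LinearAlgebra.Projectivization Matrix

namespace LineArr

noncomputable section

/-- The complex projective plane. -/
abbrev Plane : Type := ℙ ℂ (Fin 3 → ℂ)

/-- The dual projective plane: `[a : b : c]` stands for the line `a x + b y + c z = 0`. -/
abbrev Line : Type := ℙ ℂ (Fin 3 → ℂ)

/-- The set of points of a line in the projective plane. -/
def points (L : Line) : Set Plane := {p | p.orthogonal L}

/-- The multiplicity of a point `p` in a family of lines: the number of its lines through `p`. -/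
def mult {n : ℕ} (A : Fin n → Line) (p : Plane) : ℕ := {i | p ∈ points (A i)}.ncard

/-- The number `n_r` of points of multiplicity exactly `r`. -/
def numPoints {n : ℕ} (A : Fin n → Line) (r : ℕ) : ℕ∞ := {p | mult A p = r}.encard

/-- Every line passes through at least three multiple points (points of multiplicity `≥ 3`). -/
def NonReductive {n : ℕ} (A : Fin n → Line) : Prop :=
  ∀ i, 3 ≤ {p | p ∈ points (A i) ∧ 3 ≤ mult A p}.encard

/-- The linear subspace of `ℂ³` whose projectivization is the intersection of the lines `A i`,
`i ∈ S`. -/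
def flat {n : ℕ} (A : Fin n → Line) (S : Finset (Fin n)) : Submodule ℂ (Fin 3 → ℂ) where
  carrier := {v | ∀ i ∈ S, v ⬝ᵥ (A i).rep = 0}
  zero_mem' := by simp
  add_mem' := by
    intro v w hv hw i hi
    rw [add_dotProduct, hv i hi, hw i hi, add_zero]
  smul_mem' := by
    intro c v hv i hi
    rw [smul_dotProduct, hv i hi, smul_zero]

/-- `L(A) = L(B)` as labelled lattices: the intersections of the lines labelled by `S` have the
same dimension in both families, for every nonempty set `S` of labels. -/
def SameLattice {n : ℕ} (A B : Fin n → Line) : Prop :=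
  ∀ S : Finset (Fin n), S.Nonempty → Module.finrank ℂ (flat A S) = Module.finrank ℂ (flat B S)

/-- The weight on the coordinates of `(ℂ³)ⁿ` that counts the degree in the `i`-th triple. -/
def blockWeight {n : ℕ} (i : Fin n) (q : Fin n × Fin 3) : ℕ := if q.1 = i then 1 else 0

/-- Polynomials in the coordinates of `(ℂ³)ⁿ` that are homogeneous in each triple separately. -/
def Multihomogeneous {n : ℕ} (F : MvPolynomial (Fin n × Fin 3) ℂ) : Prop :=
  ∀ i : Fin n, ∃ d : ℕ, F.IsWeightedHomogeneous (blockWeight i) d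

/-- The locus in `((ℂℙ²)*)ⁿ` where `F` does not vanish. -/
def nonvanishing {n : ℕ} (F : MvPolynomial (Fin n × Fin 3) ℂ) : Set (Fin n → Line) :=
  {B | MvPolynomial.eval (fun q => (B q.1).rep q.2) F ≠ 0}

/-- The Zariski topology of the product variety `((ℂℙ²)*)ⁿ`: the closed sets are the common zero
loci of families of multihomogeneous polynomials. -/
@[reducible] def zariski (n : ℕ) : TopologicalSpace (Fin n → Line) :=
  TopologicalSpace.generateFrom {U | ∃ F, Multihomogeneous F ∧ U = nonvanishing F}

/-- The set of all `B ∈ ((ℂℙ²)*)ⁿ` with `L(B) = L(A)`. -/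
def Realization {n : ℕ} (A : Fin n → Line) : Type := {B : Fin n → Line // SameLattice B A}

/-- The Zariski topology, as a subspace of `((ℂℙ²)*)ⁿ`. -/
instance {n : ℕ} (A : Fin n → Line) : TopologicalSpace (Realization A) :=
  TopologicalSpace.induced Subtype.val (zariski n)

/-- Two families of lines are projectively equivalent if some `g ∈ PGL(3, ℂ)` maps the `i`-th line
of the first to the `i`-th line of the second, for all `i`. -/
def projEquiv {n : ℕ} (A : Fin n → Line) : Setoid (Realization A) where
  r B C := ∃ g : Matrix.ProjGenLinGroup (Fin 3) ℂ,
    ∀ i, (fun p : Plane => g • p) '' points (B.1 i) = points (C.1 i)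
  iseqv :=
    { refl := fun B => ⟨1, fun i => by simp⟩
      symm := by
        rintro B C ⟨g, hg⟩
        refine ⟨g⁻¹, fun i => ?_⟩
        rw [← hg i, Set.image_image]
        simp
      trans := by
        rintro B C D ⟨g, hg⟩ ⟨h, hh⟩
        refine ⟨h * g, fun i => ?_⟩
        rw [← hh i, ← hg i, Set.image_image]
        simp [mul_smul] }

/-- The moduli space `M_A = {B ∈ ((ℂℙ²)*)ⁿ | L(B) = L(A)} / PGL(3, ℂ)`. -/
def Moduli {n : ℕ} (A : Fin n → Line) : Type := Quotient (projEquiv A)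

/-- The quotient of the Zariski topology. -/
instance {n : ℕ} (A : Fin n → Line) : TopologicalSpace (Moduli A) :=
  inferInstanceAs (TopologicalSpace (Quotient (projEquiv A)))

/-- Complex conjugation of all homogeneous coordinates, on points (and on lines). -/
def conj : ℙ ℂ (Fin 3 → ℂ) → ℙ ℂ (Fin 3 → ℂ) :=
  Projectivization.map (starLinearEquiv ℂ : (Fin 3 → ℂ) ≃ₗ⋆[ℂ] (Fin 3 → ℂ)).toLinearMap
    (starLinearEquiv ℂ : (Fin 3 → ℂ) ≃ₗ⋆[ℂ] (Fin 3 → ℂ)).injective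

theorem conj_mk (v : Fin 3 → ℂ) (hv : v ≠ 0) :
    conj (Projectivization.mk ℂ v hv) = Projectivization.mk ℂ (star v) (star_ne_zero.2 hv) := rfl

theorem conj_conj (p : ℙ ℂ (Fin 3 → ℂ)) : conj (conj p) = p := by
  induction p using Projectivization.ind with | h v hv => simp [conj_mk]

theorem conj_orthogonal (p L : ℙ ℂ (Fin 3 → ℂ)) :
    (conj p).orthogonal (conj L) ↔ p.orthogonal L := by
  induction p using Projectivization.ind with | h v hv =>
  induction L using Projectivization.ind with | h w hw =>
  rw [conj_mk, conj_mk, Projectivization.orthogonal_mk, Projectivization.orthogonal_mk,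
    Matrix.star_dotProduct_star, dotProduct_comm w v, star_eq_zero]

theorem mem_points_conj (p : Plane) (L : Line) : p ∈ points (conj L) ↔ conj p ∈ points L := by
  have h := conj_orthogonal (conj p) L
  rwa [conj_conj] at h

theorem exists_conj_smul (g : Matrix.ProjGenLinGroup (Fin 3) ℂ) :
    ∃ h : Matrix.ProjGenLinGroup (Fin 3) ℂ, ∀ p : Plane, conj (g • p) = h • conj p := by
  induction g using Matrix.ProjGenLinGroup.induction_on with | mk g =>
  refine ⟨.mk (Matrix.GeneralLinearGroup.map (starRingEnd ℂ) g), fun p => ?_⟩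
  induction p using Projectivization.ind with | h v hv =>
  rw [Projectivization.PGL.mk_smul_mk, conj_mk, conj_mk, Projectivization.PGL.mk_smul_mk]
  congr 1
  ext i
  simp [Units.smul_def, Matrix.mulVec, dotProduct]

theorem dotProduct_rep_eq_zero_iff (v : Fin 3 → ℂ) (w : Fin 3 → ℂ) (hw : w ≠ 0) :
    v ⬝ᵥ (Projectivization.mk ℂ w hw).rep = 0 ↔ v ⬝ᵥ w = 0 := by
  obtain ⟨a, ha⟩ := Projectivization.exists_smul_eq_mk_rep ℂ w hw
  rw [← ha, dotProduct_smul, smul_eq_zero_iff_eq]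

theorem star_mem_flat_conj {n : ℕ} (A : Fin n → Line) (S : Finset (Fin n)) (v : Fin 3 → ℂ) :
    star v ∈ flat (fun i => conj (A i)) S ↔ v ∈ flat A S := by
  refine forall₂_congr fun i _ => ?_
  show star v ⬝ᵥ (conj (A i)).rep = 0 ↔ v ⬝ᵥ (A i).rep = 0
  generalize A i = L
  induction L using Projectivization.ind with | h w hw =>
  rw [conj_mk, dotProduct_rep_eq_zero_iff, dotProduct_rep_eq_zero_iff,
    Matrix.star_dotProduct_star, dotProduct_comm w v, star_eq_zero]

theorem finrank_flat_conj {n : ℕ} (A : Fin n → Line) (S : Finset (Fin n)) :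
    Module.finrank ℂ (flat (fun i => conj (A i)) S) = Module.finrank ℂ (flat A S) := by
  let j : flat A S ≃+ flat (fun i => conj (A i)) S :=
    { toFun := fun v => ⟨star v.1, (star_mem_flat_conj A S v.1).2 v.2⟩
      invFun := fun v => ⟨star v.1, (star_mem_flat_conj A S _).1 (by rw [star_star]; exact v.2)⟩
      left_inv := fun v => by simp
      right_inv := fun v => by simp
      map_add' := fun v w => by ext; simp }
  have h := rank_eq_of_equiv_equiv (starRingEnd ℂ) j (starRingAut (R := ℂ)).bijective
    (fun r m => by ext; simp [j])
  exact (congrArg Cardinal.toNat h).symm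

/-- Complex conjugation on the space of realizations. -/
def Realization.conj {n : ℕ} {A : Fin n → Line} (B : Realization A) : Realization A :=
  ⟨fun i => LineArr.conj (B.1 i), fun S hS => (finrank_flat_conj B.1 S).trans (B.2 S hS)⟩

/-- Complex conjugation on the moduli space. -/
def Moduli.conj {n : ℕ} {A : Fin n → Line} : Moduli A → Moduli A :=
  Quotient.map Realization.conj (by
    rintro B C ⟨g, hg⟩
    obtain ⟨h, hh⟩ := exists_conj_smul g
    refine ⟨h, fun i => ?_⟩
    have key : ∀ L : Line, points (LineArr.conj L) = LineArr.conj '' points L := by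
      intro L
      ext p
      rw [mem_points_conj]
      exact ⟨fun hp => ⟨_, hp, conj_conj p⟩, by rintro ⟨q, hq, rfl⟩; rwa [conj_conj]⟩
    show (fun p : Plane => h • p) '' points (LineArr.conj (B.1 i)) = points (LineArr.conj (C.1 i))
    rw [key, key, ← hg i, Set.image_image, Set.image_image]
    simp only [hh])

/-- The quotient `M^c_A` of the moduli space by complex conjugation. -/
def ConjModuli {n : ℕ} (A : Fin n → Line) : Type := Quot fun x y : Moduli A => Moduli.conj x = y

instance {n : ℕ} (A : Fin n → Line) : TopologicalSpace (ConjModuli A) :=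
  inferInstanceAs (TopologicalSpace (Quot fun x y : Moduli A => Moduli.conj x = y))

end

end LineArr

namespace LineArr

/-! Let P, Q, R be the three quadruple points.

If one line contains all three, it and three further lines at each point account for all 10 lines.
Projective maps fix the three points on the common line. Then every line has two prescribed
homogeneous coordinates, and only the third varies. Each concurrency determinant is linear in these
third coordinates, so two normalized realizations are joined by an affine pencil in which all but
finitely many members have the right lattice. Two nonempty open sets of the moduli space pull back
to cofinite subsets of this pencil and hence meet (`irreducibleSpace_moduli`,
`irreducibleSpace_moduli_of_collinear`).

If no line contains all three, counting together with non-reductivity makes P, Q, R the vertices of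
a triangle whose sides belong to the arrangement. Nine lines pass through the vertices, and the
tenth is a transversal. The third multiple point on each side can only come from the transversal and
a line through the opposite vertex (`exists_isGrid`). This leaves a normal form with three
parameters a, b, c. Third multiple points on the remaining six lines (`gridVec_first`,
`gridVec_second`) force a = b = c = -1 or ab = ac = bc = -1 (`grid_parameters`). The lattice
remembers which case holds. In the first the moduli space is one point. In the second a = b = c is a
square root of -1, and the two possible classes are exchanged by conjugation, so the quotient is a
point. -/

/-! ### Triple products and incidence of points and lines. -/

/-- The triple product of three vectors. -/
def tri {R : Type*} [CommRing R] (u v w : Fin 3 → R) : R := u ⬝ᵥ v ⨯₃ w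

theorem tri_eq {R : Type*} [CommRing R] (u v w : Fin 3 → R) :
    tri u v w = u 0 * (v 1 * w 2 - v 2 * w 1) + u 1 * (v 2 * w 0 - v 0 * w 2)
      + u 2 * (v 0 * w 1 - v 1 * w 0) := by
  simp [tri, cross_apply, dotProduct, Fin.sum_univ_three]

theorem tri_smul {R : Type*} [CommRing R] (a b c : R) (u v w : Fin 3 → R) :
    tri (a • u) (b • v) (c • w) = a * b * c * tri u v w := by
  simp only [tri_eq, Pi.smul_apply, smul_eq_mul]; ring

theorem tri_rotate {R : Type*} [CommRing R] (u v w : Fin 3 → R) : tri u v w = tri v w u := by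
  simp only [tri_eq]; ring

theorem tri_mulVec {R : Type*} [CommRing R] (M : Matrix (Fin 3) (Fin 3) R) (u v w : Fin 3 → R) :
    tri (M *ᵥ u) (M *ᵥ v) (M *ᵥ w) = M.det * tri u v w := by
  simp only [tri_eq, Matrix.mulVec, dotProduct, Fin.sum_univ_three, Matrix.det_fin_three]; ring

/-- The lines `A i`, `A j`, `A k` pass through a common point. -/
def Concurrent {n : ℕ} (A : Fin n → Line) (i j k : Fin n) : Prop :=
  tri (A i).rep (A j).rep (A k).rep = 0

theorem Concurrent.rotate {n : ℕ} {A : Fin n → Line} {i j k : Fin n} (h : Concurrent A i j k) :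
    Concurrent A j k i := by
  rw [Concurrent, ← tri_rotate]; exact h

theorem exists_smul_of_cross_eq_zero {u v : Fin 3 → ℂ} (hu : u ≠ 0) (h : u ⨯₃ v = 0) :
    ∃ c : ℂ, v = c • u := by
  by_cases hv : v = 0
  · exact ⟨0, by simp [hv]⟩
  · obtain ⟨c, hc⟩ := (Projectivization.mk_eq_mk_iff' ℂ u v hu hv).1
      ((Projectivization.mk_eq_mk_iff_crossProduct_eq_zero hu hv).2 h)
    refine ⟨c⁻¹, ?_⟩
    have : c ≠ 0 := by rintro rfl; exact hu (by rw [← hc, zero_smul])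
    rw [← hc, smul_smul, inv_mul_cancel₀ this, one_smul]

theorem cross_rep_eq_zero_iff (p q : ℙ ℂ (Fin 3 → ℂ)) : p.rep ⨯₃ q.rep = 0 ↔ p = q := by
  rw [← Projectivization.mk_eq_mk_iff_crossProduct_eq_zero p.rep_nonzero q.rep_nonzero,
    p.mk_rep, q.mk_rep]

theorem exists_smul_cross {u v w : Fin 3 → ℂ} (huv : u ⨯₃ v ≠ 0) (hu : w ⬝ᵥ u = 0)
    (hv : w ⬝ᵥ v = 0) : ∃ c : ℂ, w = c • (u ⨯₃ v) := by
  refine exists_smul_of_cross_eq_zero huv ?_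
  rw [cross_cross_eq_smul_sub_smul, dotProduct_comm, hu, dotProduct_comm v, hv, zero_smul,
    zero_smul, sub_zero]

theorem mem_points_iff (p : Plane) (L : Line) : p ∈ points L ↔ p.rep ⬝ᵥ L.rep = 0 := by
  conv_lhs => rw [← p.mk_rep, ← L.mk_rep]
  exact Projectivization.orthogonal_mk p.rep_nonzero L.rep_nonzero

theorem mk_mem_points_iff {v : Fin 3 → ℂ} (hv : v ≠ 0) (L : Line) :
    Projectivization.mk ℂ v hv ∈ points L ↔ v ⬝ᵥ L.rep = 0 := by
  conv_lhs => rw [← L.mk_rep]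
  exact Projectivization.orthogonal_mk hv L.rep_nonzero

theorem exists_mem_points (K L : Line) : ∃ p : Plane, p ∈ points K ∧ p ∈ points L := by
  by_cases h : K = L
  · obtain ⟨v, hv, h0⟩ := Matrix.exists_mulVec_eq_zero_iff (M := Matrix.of ![K.rep, K.rep, 0]).2
      (Matrix.det_eq_zero_of_row_eq_zero 2 (by simp))
    have := congrFun h0 0
    have h1 : v ⬝ᵥ K.rep = 0 := by rw [dotProduct_comm]; simpa [Matrix.mulVec] using this
    exact ⟨.mk ℂ v hv, (mk_mem_points_iff hv K).2 h1, h ▸ (mk_mem_points_iff hv K).2 h1⟩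
  · have h' := (cross_rep_eq_zero_iff K L).not.2 h
    refine ⟨.mk ℂ _ h', (mk_mem_points_iff h' K).2 ?_, (mk_mem_points_iff h' L).2 ?_⟩
    · rw [dotProduct_comm, dot_self_cross]
    · rw [dotProduct_comm, dot_cross_self]

theorem eq_of_mem_points {K L : Line} (h : K ≠ L) {p q : Plane} (hpK : p ∈ points K)
    (hpL : p ∈ points L) (hqK : q ∈ points K) (hqL : q ∈ points L) : p = q := by
  have h' := (cross_rep_eq_zero_iff K L).not.2 h
  rw [mem_points_iff] at *
  obtain ⟨c, hc⟩ := exists_smul_cross h' hpK hpL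
  obtain ⟨d, hd⟩ := exists_smul_cross h' hqK hqL
  rw [← cross_rep_eq_zero_iff, hc, hd]
  simp [cross_self]

theorem concurrent_of_mem {n : ℕ} {A : Fin n → Line} {i j k : Fin n} {p : Plane}
    (hi : p ∈ points (A i)) (hj : p ∈ points (A j)) (hk : p ∈ points (A k)) :
    Concurrent A i j k := by
  rw [mem_points_iff] at *
  rw [Concurrent, tri, triple_product_eq_det]
  refine Matrix.exists_mulVec_eq_zero_iff.1 ⟨p.rep, p.rep_nonzero, ?_⟩
  ext t
  fin_cases t <;> simp [Matrix.mulVec, dotProduct_comm _ p.rep, *]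

theorem Concurrent.mem {n : ℕ} {A : Fin n → Line} {i j k : Fin n} {p : Plane}
    (h : Concurrent A i j k) (hij : A i ≠ A j) (hi : p ∈ points (A i)) (hj : p ∈ points (A j)) :
    p ∈ points (A k) := by
  rw [mem_points_iff] at *
  obtain ⟨c, hc⟩ := exists_smul_cross ((cross_rep_eq_zero_iff _ _).not.2 hij) hi hj
  rw [hc, smul_dotProduct, dotProduct_comm]
  have : tri (A k).rep (A i).rep (A j).rep = 0 := by rw [tri_rotate]; exact h
  rw [tri] at this
  rw [this, smul_zero]

/-! ### The labelled lattice as concurrency data. -/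

-- Two distinct lines already cut the flat down to the span of their cross product, so only
-- concurrency of the other lines with these two matters.
open Classical in
theorem finrank_flat_of_ne {n : ℕ} (A : Fin n → Line) {S : Finset (Fin n)} {i j : Fin n}
    (hi : i ∈ S) (hj : j ∈ S) (hij : A i ≠ A j) :
    Module.finrank ℂ (flat A S) = if ∀ k ∈ S, Concurrent A i j k then 1 else 0 := by
  have h' := (cross_rep_eq_zero_iff _ _).not.2 hij
  have hc : ∀ k, Concurrent A i j k ↔ (A i).rep ⨯₃ (A j).rep ⬝ᵥ (A k).rep = 0 := fun k => by
    rw [Concurrent, ← tri_rotate, tri, dotProduct_comm]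
  split_ifs with h
  · have : flat A S = Submodule.span ℂ {(A i).rep ⨯₃ (A j).rep} := by
      ext v
      rw [Submodule.mem_span_singleton]
      constructor
      · intro hv
        obtain ⟨c, hc⟩ := exists_smul_cross h' (hv i hi) (hv j hj)
        exact ⟨c, hc.symm⟩
      · rintro ⟨c, rfl⟩ k hk
        rw [smul_dotProduct, (hc k).1 (h k hk), smul_zero]
    rw [this, finrank_span_singleton h']
  · have : flat A S = ⊥ := by
      rw [eq_bot_iff]
      intro v hv
      obtain ⟨c, rfl⟩ := exists_smul_cross h' (hv i hi) (hv j hj)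
      push Not at h
      obtain ⟨k, hk, hk'⟩ := h
      have := hv k hk
      rw [smul_dotProduct, smul_eq_mul, mul_eq_zero] at this
      rw [hc] at hk'
      rw [this.resolve_right hk', zero_smul]
      exact Submodule.zero_mem _
    rw [this, finrank_bot]

theorem finrank_flat_of_forall_eq {n : ℕ} (A : Fin n → Line) {S : Finset (Fin n)} {i : Fin n}
    (hi : i ∈ S) (h : ∀ j ∈ S, A j = A i) : Module.finrank ℂ (flat A S) = 2 := by
  let f : Module.Dual ℂ (Fin 3 → ℂ) := dotProductBilin ℂ ℂ (A i).rep
  have hf : f ≠ 0 := by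
    intro h0
    refine (A i).rep_nonzero (dotProduct_eq_zero _ fun w => ?_)
    simpa [f] using LinearMap.congr_fun h0 w
  have hk : flat A S = LinearMap.ker f := by
    ext v
    rw [LinearMap.mem_ker]
    show (∀ j ∈ S, _) ↔ (A i).rep ⬝ᵥ v = 0
    rw [dotProduct_comm]
    exact ⟨fun hv => hv i hi, fun hv j hj => by rw [h j hj]; exact hv⟩
  have := Module.Dual.finrank_ker_add_one_of_ne_zero hf
  rw [Module.finrank_fin_fun] at this
  rw [hk]; omega

theorem SameLattice.injective {n : ℕ} {A B : Fin n → Line} (h : SameLattice B A)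
    (hA : Function.Injective A) : Function.Injective B := by
  intro i j hij
  by_contra hne
  have h1 := h {i, j} (by simp)
  rw [finrank_flat_of_forall_eq B (i := i) (by simp) (by simp [hij]),
    finrank_flat_of_ne A (i := i) (j := j) (by simp) (by simp) (hA.ne hne)] at h1
  split_ifs at h1; omega

theorem concurrent_self_left {n : ℕ} (A : Fin n → Line) (i k : Fin n) : Concurrent A i i k := by
  rw [Concurrent, tri_eq]; ring

theorem SameLattice.concurrent_iff {n : ℕ} {A B : Fin n → Line} (h : SameLattice B A)
    (hA : Function.Injective A) (i j k : Fin n) : Concurrent B i j k ↔ Concurrent A i j k := by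
  by_cases hij : i = j
  · subst hij; simp only [concurrent_self_left]
  have key : ∀ C : Fin n → Line, (∀ l ∈ ({i, j, k} : Finset (Fin n)), Concurrent C i j l) ↔
      Concurrent C i j k := by
    intro C
    simp only [Finset.mem_insert, Finset.mem_singleton, forall_eq_or_imp, forall_eq]
    have h1 : Concurrent C i j i := by rw [Concurrent, tri_eq]; ring
    have h2 : Concurrent C i j j := by rw [Concurrent, tri_eq]; ring
    tauto
  have h1 := h {i, j, k} (by simp)
  rw [finrank_flat_of_ne A (i := i) (j := j) (by simp) (by simp) (hA.ne hij),
    finrank_flat_of_ne B (i := i) (j := j) (by simp) (by simp) ((h.injective hA).ne hij)] at h1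
  classical
  rw [if_congr (key A) rfl rfl, if_congr (key B) rfl rfl] at h1
  split_ifs at h1 <;> tauto

/-- For distinct lines a flat has dimension 2 for a single label, and otherwise 1 or 0 according to
concurrency. Hence triples of labels determine all dimensions. -/
theorem sameLattice_of_concurrent_iff {n : ℕ} {A B : Fin n → Line} (hA : Function.Injective A)
    (hB : Function.Injective B) (h : ∀ i j k, Concurrent B i j k ↔ Concurrent A i j k) :
    SameLattice B A := by
  rintro S ⟨i, hi⟩
  by_cases hS : ∃ j ∈ S, i ≠ j
  · obtain ⟨j, hj, hij⟩ := hS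
    rw [finrank_flat_of_ne A hi hj (hA.ne hij), finrank_flat_of_ne B hi hj (hB.ne hij)]
    congr 1
    exact propext (forall₂_congr fun k _ => h i j k)
  · push Not at hS
    rw [finrank_flat_of_forall_eq A hi fun j hj => by rw [hS j hj],
      finrank_flat_of_forall_eq B hi fun j hj => by rw [hS j hj]]

/-! ### Normal forms up to linear change of coordinates. -/

/-- After a linear change of coordinates, the vectors `s i` represent the lines `B i`. -/
def Normal {n : ℕ} (B : Fin n → Line) (s : Fin n → Fin 3 → ℂ) : Prop :=
  ∃ M : Matrix (Fin 3) (Fin 3) ℂ, M.det ≠ 0 ∧ ∀ i, ∃ k : ℂ, k ≠ 0 ∧ M *ᵥ (B i).rep = k • s i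

theorem normal_rep {n : ℕ} (B : Fin n → Line) : Normal B fun i => (B i).rep :=
  ⟨1, by simp, fun i => ⟨1, one_ne_zero, by simp⟩⟩

theorem Normal.trans {n : ℕ} {B : Fin n → Line} {s t : Fin n → Fin 3 → ℂ} (h : Normal B s)
    {N : Matrix (Fin 3) (Fin 3) ℂ} (hN : N.det ≠ 0)
    (hst : ∀ i, ∃ k : ℂ, k ≠ 0 ∧ N *ᵥ s i = k • t i) : Normal B t := by
  obtain ⟨M, hM, hs⟩ := h
  refine ⟨N * M, by simp [hM, hN], fun i => ?_⟩
  obtain ⟨k, hk, hki⟩ := hs i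
  obtain ⟨l, hl, hli⟩ := hst i
  exact ⟨k * l, mul_ne_zero hk hl, by
    rw [← Matrix.mulVec_mulVec, hki, Matrix.mulVec_smul, hli, smul_smul]⟩

theorem Normal.rescale {n : ℕ} {B : Fin n → Line} {s t : Fin n → Fin 3 → ℂ} (h : Normal B s)
    (hst : ∀ i, ∃ k : ℂ, k ≠ 0 ∧ s i = k • t i) : Normal B t :=
  h.trans (N := 1) (by simp) fun i => by simpa using hst i

theorem mulVec_eq_zero {M : Matrix (Fin 3) (Fin 3) ℂ} (hM : M.det ≠ 0) {v : Fin 3 → ℂ}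
    (h : M *ᵥ v = 0) : v = 0 := by
  by_contra hv
  exact hM (Matrix.exists_mulVec_eq_zero_iff.1 ⟨v, hv, h⟩)

theorem Normal.ne_zero {n : ℕ} {B : Fin n → Line} {s : Fin n → Fin 3 → ℂ} (h : Normal B s)
    (i : Fin n) : s i ≠ 0 := by
  obtain ⟨M, hM, hs⟩ := h
  obtain ⟨k, hk, hki⟩ := hs i
  intro h0
  rw [h0, smul_zero] at hki
  exact (B i).rep_nonzero (mulVec_eq_zero hM hki)

theorem Normal.eq_iff {n : ℕ} {B : Fin n → Line} {s : Fin n → Fin 3 → ℂ} (h : Normal B s)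
    (i j : Fin n) : B i = B j ↔ s i ⨯₃ s j = 0 := by
  have h0 := h.ne_zero
  obtain ⟨M, hM, hs⟩ := h
  obtain ⟨k, hk, hki⟩ := hs i
  obtain ⟨l, hl, hlj⟩ := hs j
  constructor
  · intro hij
    rw [hij, hlj] at hki
    have : s i = (k⁻¹ * l) • s j := by rw [← smul_smul, hki, smul_smul, inv_mul_cancel₀ hk, one_smul]
    rw [this]; simp [cross_self]
  · intro h
    obtain ⟨c, hc⟩ := exists_smul_of_cross_eq_zero (h0 i) h
    have : M *ᵥ ((B j).rep - (l * c * k⁻¹) • (B i).rep) = 0 := by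
      rw [Matrix.mulVec_sub, Matrix.mulVec_smul, hki, hlj, hc, smul_smul, smul_smul,
        inv_mul_cancel_right₀ hk, sub_self]
    rw [← cross_rep_eq_zero_iff, sub_eq_zero.1 (mulVec_eq_zero hM this)]
    simp [cross_self]

theorem Normal.concurrent_iff {n : ℕ} {B : Fin n → Line} {s : Fin n → Fin 3 → ℂ} (h : Normal B s)
    (i j k : Fin n) : Concurrent B i j k ↔ tri (s i) (s j) (s k) = 0 := by
  obtain ⟨M, hM, hs⟩ := h
  obtain ⟨a, ha, hai⟩ := hs i
  obtain ⟨b, hb, hbj⟩ := hs j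
  obtain ⟨c, hc, hck⟩ := hs k
  have := tri_mulVec M (B i).rep (B j).rep (B k).rep
  rw [hai, hbj, hck, tri_smul] at this
  rw [Concurrent]
  constructor <;> intro h0 <;> rw [h0] at this
  · simpa [ha, hb, hc] using this
  · simpa [hM] using this.symm

open Classical in
/-- The line with coordinate vector `v` (a fixed line if `v = 0`). -/
noncomputable def lineOf (v : Fin 3 → ℂ) : Line :=
  if hv : v ≠ 0 then .mk ℂ v hv else .mk ℂ 1 one_ne_zero

theorem exists_rep_lineOf {v : Fin 3 → ℂ} (hv : v ≠ 0) :
    ∃ k : ℂ, k ≠ 0 ∧ (lineOf v).rep = k • v := by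
  obtain ⟨a, ha⟩ := Projectivization.exists_smul_eq_mk_rep ℂ v hv
  exact ⟨a, a.ne_zero, by rw [lineOf, dif_pos hv, ← ha]; rfl⟩

theorem normal_lineOf {n : ℕ} {s : Fin n → Fin 3 → ℂ} (hs : ∀ i, s i ≠ 0) :
    Normal (fun i => lineOf (s i)) s :=
  (normal_rep _).rescale fun i => exists_rep_lineOf (hs i)

theorem Normal.exists_vector {n : ℕ} {B : Fin n → Line} {s : Fin n → Fin 3 → ℂ} (h : Normal B s)
    (p : Plane) : ∃ z : Fin 3 → ℂ, z ≠ 0 ∧ ∀ i, p ∈ points (B i) ↔ z ⬝ᵥ s i = 0 := by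
  obtain ⟨M, hM, hs⟩ := h
  have hM' : IsUnit M.det := isUnit_iff_ne_zero.2 hM
  refine ⟨p.rep ᵥ* M⁻¹, fun h0 => p.rep_nonzero ?_, fun i => ?_⟩
  · have := congrArg (· ᵥ* M) h0
    simpa [Matrix.vecMul_vecMul, Matrix.nonsing_inv_mul M hM'] using this
  · obtain ⟨k, hk, hki⟩ := hs i
    have : (p.rep ᵥ* M⁻¹) ⬝ᵥ (k • s i) = p.rep ⬝ᵥ (B i).rep := by
      rw [← hki, ← Matrix.dotProduct_mulVec, Matrix.mulVec_mulVec, Matrix.nonsing_inv_mul M hM',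
        Matrix.one_mulVec]
    rw [mem_points_iff, ← this, dotProduct_smul, smul_eq_mul, mul_eq_zero, or_iff_right hk]

theorem image_points {g : GL (Fin 3) ℂ} {K L : Line} {k : ℂ} (hk : k ≠ 0)
    (h : K.rep = k • (L.rep ᵥ* (g : Matrix (Fin 3) (Fin 3) ℂ))) :
    (fun p : Plane => Matrix.ProjGenLinGroup.mk g • p) '' points K = points L := by
  have key : ∀ p : Plane, Matrix.ProjGenLinGroup.mk g • p ∈ points L ↔ p ∈ points K := by
    intro p
    induction p using Projectivization.ind with | h v hv =>
    rw [Projectivization.PGL.mk_smul_mk, mk_mem_points_iff, mk_mem_points_iff, h,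
      dotProduct_smul, smul_eq_mul, mul_eq_zero, or_iff_right hk, dotProduct_comm v,
      ← Matrix.dotProduct_mulVec, dotProduct_comm]
    rfl
  ext p
  constructor
  · rintro ⟨q, hq, rfl⟩
    exact (key q).2 hq
  · intro hp
    refine ⟨(Matrix.ProjGenLinGroup.mk g)⁻¹ • p, (key _).1 ?_, ?_⟩ <;> simp [hp]

/-- A shared normal form means the same class in the moduli space. `Normal` acts on covectors and
`projEquiv` on points, hence the transpose in the matrix. -/
theorem Normal.projEquiv {n : ℕ} {A : Fin n → Line} {B C : Realization A}
    {s : Fin n → Fin 3 → ℂ} (hB : Normal B.1 s) (hC : Normal C.1 s) : projEquiv A B C := by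
  obtain ⟨M, hM, hM'⟩ := hB
  obtain ⟨N, hN, hN'⟩ := hC
  have hMu : IsUnit M.det := isUnit_iff_ne_zero.2 hM
  have hT : (M⁻¹ * N)ᵀ.det ≠ 0 := by
    rw [Matrix.det_transpose, Matrix.det_mul, Matrix.det_nonsing_inv, Ring.inverse_eq_inv']
    exact mul_ne_zero (inv_ne_zero hM) hN
  refine ⟨.mk (Matrix.GeneralLinearGroup.mkOfDetNeZero _ hT), fun i => ?_⟩
  obtain ⟨k, hk, hki⟩ := hM' i
  obtain ⟨l, hl, hli⟩ := hN' i
  refine image_points (k := k * l⁻¹) (mul_ne_zero hk (inv_ne_zero hl)) ?_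
  have : ((Matrix.GeneralLinearGroup.mkOfDetNeZero _ hT : GL (Fin 3) ℂ) :
    Matrix (Fin 3) (Fin 3) ℂ) = (M⁻¹ * N)ᵀ := rfl
  rw [this, Matrix.vecMul_transpose, ← Matrix.mulVec_mulVec, hli, Matrix.mulVec_smul, smul_smul,
    inv_mul_cancel_right₀ hl, ← Matrix.mulVec_smul, ← hki, Matrix.mulVec_mulVec,
    Matrix.nonsing_inv_mul M hMu, Matrix.one_mulVec]

/-! ### Zariski open sets along affine pencils of arrangements. -/

/-- Rescaling the triples multiplies the value by the product of the `k i ^ d i`. Thus the arbitrary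
representatives in `nonvanishing` may be replaced by any others. -/
theorem Multihomogeneous.eval_rescale {n : ℕ} {F : MvPolynomial (Fin n × Fin 3) ℂ}
    (hF : Multihomogeneous F) {x y : Fin n × Fin 3 → ℂ} {k : Fin n → ℂ} (hk : ∀ i, k i ≠ 0)
    (hxy : ∀ q, x q = k q.1 * y q) : MvPolynomial.eval x F = 0 ↔ MvPolynomial.eval y F = 0 := by
  choose d hd using hF
  have key : MvPolynomial.eval x F = (∏ i, k i ^ d i) * MvPolynomial.eval y F := by
    rw [MvPolynomial.eval_eq', MvPolynomial.eval_eq', Finset.mul_sum]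
    refine Finset.sum_congr rfl fun m hm => ?_
    have h1 : ∏ q : Fin n × Fin 3, k q.1 ^ m q = ∏ i, k i ^ d i := by
      rw [Fintype.prod_prod_type]
      refine Finset.prod_congr rfl fun i _ => ?_
      have h2 : ∏ c : Fin 3, k (i, c).1 ^ m (i, c) = k i ^ ∑ c, m (i, c) :=
        Finset.prod_pow_eq_pow_sum Finset.univ (fun c => m (i, c)) (k i)
      rw [h2, ← hd i (MvPolynomial.mem_support_iff.1 hm),
        Finsupp.weight_apply, Finsupp.sum_fintype _ _ (by simp), Fintype.sum_prod_type,
        Finset.sum_eq_single i]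
      · simp [blockWeight]
      · intro j _ hj
        simp [blockWeight, hj]
      · simp
    simp only [hxy, mul_pow, Finset.prod_mul_distrib, h1]
    ring
  rw [key, mul_eq_zero, or_iff_right (Finset.prod_ne_zero_iff.2 fun i _ => pow_ne_zero _ (hk i))]

theorem eventually_eval_ne_zero {p : Polynomial ℂ} {t₀ : ℂ} (h : p.eval t₀ ≠ 0) :
    ∀ᶠ t in Filter.cofinite, p.eval t ≠ 0 := by
  have hp : p ≠ 0 := by rintro rfl; simp at h
  rw [Filter.eventually_cofinite]
  simpa [Polynomial.IsRoot] using Polynomial.finite_setOfPred_isRoot hp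

theorem eval_aeval_polynomial {σ : Type*} (x : σ → Polynomial ℂ) (F : MvPolynomial σ ℂ) (t : ℂ) :
    (MvPolynomial.aeval x F).eval t = MvPolynomial.eval (fun q => (x q).eval t) F := by
  induction F using MvPolynomial.induction_on with
  | C a => simp
  | add p q hp hq => simp [hp, hq]
  | mul_X p q hp => simp [hp]

section Interpolation

variable {n : ℕ} (f g h h' : Fin n → ℂ)

/-- Coordinate vectors of a linear family of lines. -/
noncomputable def pencil (t : ℂ) (i : Fin n) : Fin 3 → ℂ :=
  ![f i, g i, h i + t * (h' i - h i)]

/-- The coordinates of `pencil` as polynomials in the parameter. -/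
noncomputable def pencilPoly (i : Fin n) : Fin 3 → Polynomial ℂ :=
  ![.C (f i), .C (g i), .C (h i) + .X * .C (h' i - h i)]

theorem eval_pencilPoly (t : ℂ) (i : Fin n) (c : Fin 3) :
    (pencilPoly f g h h' i c).eval t = pencil f g h h' t i c := by
  fin_cases c <;> simp [pencil, pencilPoly]

theorem eval_cross_pencilPoly (t : ℂ) (i j : Fin n) (c : Fin 3) :
    ((pencilPoly f g h h' i ⨯₃ pencilPoly f g h h' j) c).eval t =
      (pencil f g h h' t i ⨯₃ pencil f g h h' t j) c := by
  fin_cases c <;> simp [cross_apply, eval_pencilPoly]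

theorem eval_tri_pencilPoly (t : ℂ) (i j k : Fin n) :
    (tri (pencilPoly f g h h' i) (pencilPoly f g h h' j) (pencilPoly f g h h' k)).eval t =
      tri (pencil f g h h' t i) (pencil f g h h' t j) (pencil f g h h' t k) := by
  simp [tri_eq, eval_pencilPoly]

/-- The first two coordinates do not depend on `t`, and a determinant is linear in its third column.
-/
theorem tri_pencil (t : ℂ) (i j k : Fin n) :
    tri (pencil f g h h' t i) (pencil f g h h' t j) (pencil f g h h' t k) =
      (1 - t) * tri (pencil f g h h' 0 i) (pencil f g h h' 0 j) (pencil f g h h' 0 k) +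
        t * tri (pencil f g h h' 1 i) (pencil f g h h' 1 j) (pencil f g h h' 1 k) := by
  simp [tri_eq, pencil]; ring

variable {f g h h'}

theorem eventually_pencil_ne_zero {t₀ : ℂ} (h₀ : ∀ i, pencil f g h h' t₀ i ≠ 0) :
    ∀ᶠ t in Filter.cofinite, ∀ i, pencil f g h h' t i ≠ 0 := by
  rw [Filter.eventually_all]
  intro i
  obtain ⟨c, hc⟩ := Function.ne_iff.1 (h₀ i)
  rw [← eval_pencilPoly] at hc
  filter_upwards [eventually_eval_ne_zero hc] with t ht h0
  rw [eval_pencilPoly, h0] at ht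
  exact ht rfl

/-- On a basic open set, membership is the nonvanishing of one polynomial in `t`, nonzero at `t₀`.
Finite intersections and unions preserve the cofinite conclusion. -/
theorem eventually_pencil_mem {W : Set (Fin n → Line)} (hW : @IsOpen _ (zariski n) W) {t₀ : ℂ}
    (h₀ : ∀ i, pencil f g h h' t₀ i ≠ 0) (hmem : (fun i => lineOf (pencil f g h h' t₀ i)) ∈ W) :
    ∀ᶠ t in Filter.cofinite, (fun i => lineOf (pencil f g h h' t i)) ∈ W := by
  induction hW with
  | basic s hs =>
    obtain ⟨F, hF, rfl⟩ := hs
    have key : ∀ t, (∀ i, pencil f g h h' t i ≠ 0) →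
        ((fun i => lineOf (pencil f g h h' t i)) ∈ nonvanishing F ↔
          (MvPolynomial.aeval (fun q => pencilPoly f g h h' q.1 q.2) F).eval t ≠ 0) := by
      intro t ht
      choose k hk hk' using fun i => exists_rep_lineOf (ht i)
      have h1 : (MvPolynomial.aeval (fun q => pencilPoly f g h h' q.1 q.2) F).eval t =
          MvPolynomial.eval (fun q => pencil f g h h' t q.1 q.2) F := by
        simp only [← eval_pencilPoly, eval_aeval_polynomial]
      rw [h1]
      exact (hF.eval_rescale hk fun q => by simp [hk']).not
    filter_upwards [eventually_pencil_ne_zero h₀, eventually_eval_ne_zero ((key _ h₀).1 hmem)]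
      with t ht ht'
    exact (key t ht).2 ht'
  | univ => simp
  | inter s t _ _ hs ht =>
    filter_upwards [hs hmem.1, ht hmem.2] with t h1 h2 using ⟨h1, h2⟩
  | sUnion S _ hS =>
    obtain ⟨s, hs, hs'⟩ := hmem
    filter_upwards [hS s hs hs'] with t ht using ⟨s, hs, ht⟩

theorem eventually_sameLattice_pencil {A : Fin n → Line} (hA : Function.Injective A)
    {B B' : Realization A} (hB : Normal B.1 (pencil f g h h' 0))
    (hB' : Normal B'.1 (pencil f g h h' 1)) :
    ∀ᶠ t in Filter.cofinite, SameLattice (fun i => lineOf (pencil f g h h' t i)) A := by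
  have hcross : ∀ᶠ t in Filter.cofinite, ∀ i j, i ≠ j →
      pencil f g h h' t i ⨯₃ pencil f g h h' t j ≠ 0 := by
    simp only [Filter.eventually_all]
    intro i j hij
    have h0 := (hB.eq_iff i j).not.1 ((B.2.injective hA).ne hij)
    obtain ⟨c, hc⟩ := Function.ne_iff.1 h0
    rw [← eval_cross_pencilPoly] at hc
    filter_upwards [eventually_eval_ne_zero hc] with t ht h0
    rw [eval_cross_pencilPoly, h0] at ht
    exact ht rfl
  have htri : ∀ᶠ t in Filter.cofinite, ∀ i j k,
      tri (pencil f g h h' t i) (pencil f g h h' t j) (pencil f g h h' t k) = 0 ↔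
        Concurrent A i j k := by
    simp only [Filter.eventually_all]
    intro i j k
    have h0 := (hB.concurrent_iff i j k).symm.trans (B.2.concurrent_iff hA i j k)
    have h1 := (hB'.concurrent_iff i j k).symm.trans (B'.2.concurrent_iff hA i j k)
    -- A determinant vanishing at both ends vanishes on the whole pencil; one that is nonzero at 0
    -- has finitely many zeros.
    by_cases hc : Concurrent A i j k
    · refine .of_forall fun t => ?_
      rw [tri_pencil, h0.2 hc, h1.2 hc]
      simp [hc]
    · have h2 := h0.not.2 hc
      rw [← eval_tri_pencilPoly] at h2
      filter_upwards [eventually_eval_ne_zero h2] with t ht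
      rw [eval_tri_pencilPoly] at ht
      simp [hc, ht]
  filter_upwards [eventually_pencil_ne_zero hB.ne_zero, hcross, htri] with t h0 h1 h2
  have hN := normal_lineOf h0
  refine sameLattice_of_concurrent_iff hA (fun i j hij => ?_) fun i j k => ?_
  · by_contra hne
    exact h1 i j hne ((hN.eq_iff i j).1 hij)
  · rw [hN.concurrent_iff, h2]

end Interpolation

/-- A family of lines with the lattice of `A`, as a realization of `A`. -/
def Realization.of {n : ℕ} {A : Fin n → Line} (B : Fin n → Line) (h : SameLattice B A) :
    Realization A := ⟨B, h⟩

/-- The functions `f` and `g` are common to all realizations, so any two of them are the members at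
0 and 1 of one pencil. -/
theorem irreducibleSpace_moduli {n : ℕ} {A : Fin n → Line} (hA : Function.Injective A)
    (f g : Fin n → ℂ) (hn : ∀ B : Realization A, ∃ h : Fin n → ℂ,
      Normal B.1 fun i => ![f i, g i, h i]) : IrreducibleSpace (Moduli A) := by
  have : Nonempty (Moduli A) := ⟨Quotient.mk _ (Realization.of A fun _ _ => rfl)⟩
  refine @IrreducibleSpace.mk _ _ ⟨?_⟩ this
  rintro U V hU hV ⟨x, -, hx⟩ ⟨y, -, hy⟩
  induction x using Quotient.ind with | _ B
  induction y using Quotient.ind with | _ C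
  obtain ⟨h, hB⟩ := hn B
  obtain ⟨h', hC⟩ := hn C
  have hB' : Normal B.1 (pencil f g h h' 0) := by convert hB using 2; simp [pencil]
  have hC' : Normal C.1 (pencil f g h h' 1) := by convert hC using 2; simp [pencil]
  let π : Realization A → Moduli A := Quotient.mk _
  have key : ∀ {W : Set (Moduli A)} {D : Realization A} {t₀ : ℂ}, IsOpen W →
      Normal D.1 (pencil f g h h' t₀) → π D ∈ W → ∀ᶠ t in Filter.cofinite,
      ∀ ht : SameLattice (fun i => lineOf (pencil f g h h' t i)) A, π (.of _ ht) ∈ W := by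
    intro W D t₀ hW hD hDW
    have hπ : Continuous π := continuous_quot_mk
    obtain ⟨W', hW', hWW'⟩ := (isOpen_induced_iff (t := zariski n)).1 (hW.preimage hπ)
    -- `D` need not itself be the pencil member at `t₀`, but the two have the same class, so
    -- openness can be used at that member.
    have hN := normal_lineOf hD.ne_zero
    have hS : SameLattice (fun i => lineOf (pencil f g h h' t₀ i)) A := by
      refine sameLattice_of_concurrent_iff hA (fun i j hij => ?_) fun i j k => ?_
      · exact D.2.injective hA ((hD.eq_iff i j).2 ((hN.eq_iff i j).1 hij))
      · rw [hN.concurrent_iff, ← hD.concurrent_iff, D.2.concurrent_iff hA]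
    have hmem : Realization.of _ hS ∈ π ⁻¹' W := by
      have : π (.of _ hS) = π D := Quotient.sound (Normal.projEquiv (B := .of _ hS) hN hD)
      rwa [Set.mem_preimage, this]
    rw [← hWW'] at hmem
    filter_upwards [eventually_pencil_mem hW' hD.ne_zero hmem] with t ht hts
    have : Realization.of _ hts ∈ π ⁻¹' W := by rw [← hWW']; exact ht
    exact this
  -- Three cofinite conditions on a parameter in the infinite field ℂ have a common solution.
  obtain ⟨t, ht, h1, h2⟩ := ((eventually_sameLattice_pencil hA hB' hC').and
    ((key hU hB' hx).and (key hV hC' hy))).exists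
  exact ⟨_, trivial, h1 ht, h2 ht⟩

/-! ### Coordinate frames, and lines meeting a fixed line in three points. -/

section Frames

theorem exists_normal_of_basis {n : ℕ} {B : Fin n → Line} {s : Fin n → Fin 3 → ℂ}
    (hB : Normal B s) {u v w : Fin 3 → ℂ} (h : tri u v w ≠ 0) :
    ∃ t : Fin n → Fin 3 → ℂ, Normal B t ∧ ∀ i, s i = t i 0 • u + t i 1 • v + t i 2 • w := by
  set N : Matrix (Fin 3) (Fin 3) ℂ := (Matrix.of ![u, v, w])ᵀ with hN
  have hd : IsUnit N.det := by
    rw [isUnit_iff_ne_zero, hN, Matrix.det_transpose]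
    rwa [tri, triple_product_eq_det] at h
  have hd' : N⁻¹.det ≠ 0 := (Matrix.isUnit_nonsing_inv_det N hd).ne_zero
  refine ⟨fun i => N⁻¹ *ᵥ s i, hB.trans hd' fun i => ⟨1, one_ne_zero, by simp⟩, fun i => ?_⟩
  have h1 : N *ᵥ (N⁻¹ *ᵥ s i) = s i := by
    rw [Matrix.mulVec_mulVec, Matrix.mul_nonsing_inv N hd, Matrix.one_mulVec]
  conv_lhs => rw [← h1]
  ext c
  simp [Matrix.mulVec, dotProduct, Fin.sum_univ_three, hN]
  ring

theorem eq_of_comb {u v w : Fin 3 → ℂ} (h : tri u v w ≠ 0) {x y z x' y' z' : ℂ}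
    (he : x • u + y • v + z • w = x' • u + y' • v + z' • w) : x = x' ∧ y = y' ∧ z = z' := by
  have h0 := congrFun he 0
  have h1 := congrFun he 1
  have h2 := congrFun he 2
  simp only [Pi.add_apply, Pi.smul_apply, smul_eq_mul] at h0 h1 h2
  rw [tri_eq] at h
  refine ⟨mul_right_cancel₀ h ?_, mul_right_cancel₀ h ?_, mul_right_cancel₀ h ?_⟩
  · linear_combination (v 1 * w 2 - v 2 * w 1) * h0 + (v 2 * w 0 - v 0 * w 2) * h1 +
      (v 0 * w 1 - v 1 * w 0) * h2
  · linear_combination (w 1 * u 2 - w 2 * u 1) * h0 + (w 2 * u 0 - w 0 * u 2) * h1 +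
      (w 0 * u 1 - w 1 * u 0) * h2
  · linear_combination (u 1 * v 2 - u 2 * v 1) * h0 + (u 2 * v 0 - u 0 * v 2) * h1 +
      (u 0 * v 1 - u 1 * v 0) * h2

/-- Three lines in general position become the coordinate lines. -/
theorem exists_normal_frame {n : ℕ} {B : Fin n → Line} {i j k : Fin n}
    (h : ¬ Concurrent B i j k) : ∃ s : Fin n → Fin 3 → ℂ, Normal B s ∧ s i = ![1, 0, 0] ∧
      s j = ![0, 1, 0] ∧ s k = ![0, 0, 1] := by
  obtain ⟨t, ht, hs⟩ := exists_normal_of_basis (normal_rep B) h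
  have hi := eq_of_comb (x := 1) (y := 0) (z := 0) h (by simpa using hs i)
  have hj := eq_of_comb (x := 0) (y := 1) (z := 0) h (by simpa using hs j)
  have hk := eq_of_comb (x := 0) (y := 0) (z := 1) h (by simpa using hs k)
  refine ⟨t, ht, ?_, ?_, ?_⟩ <;> ext c <;> fin_cases c <;> simp [← hi, ← hj, ← hk]

/-- Scaling the coordinates of a normal form. -/
theorem Normal.scale {n : ℕ} {B : Fin n → Line} {s : Fin n → Fin 3 → ℂ} (h : Normal B s)
    {x y z : ℂ} (hx : x ≠ 0) (hy : y ≠ 0) (hz : z ≠ 0) :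
    Normal B fun i => ![s i 0 / x, s i 1 / y, s i 2 / z] := by
  refine h.trans (N := Matrix.diagonal ![x⁻¹, y⁻¹, z⁻¹]) ?_ fun i => ⟨1, one_ne_zero, ?_⟩
  · simp [Matrix.det_diagonal, Fin.prod_univ_three, hx, hy, hz]
  · ext c
    fin_cases c <;> simp [Matrix.mulVec_diagonal, div_eq_inv_mul]

end Frames

/-- With `l = [0:0:1]`, the first two coordinates of another line record where it meets `l`. The
three points where `a`, `b`, `c` meet `l` are moved to the directions (1,0), (0,1), (1,1). -/
theorem irreducibleSpace_moduli_of_collinear {n : ℕ} {A : Fin n → Line}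
    (hA : Function.Injective A) {l a b c : Fin n} (hab : ¬ Concurrent A a b l)
    (hac : ¬ Concurrent A a c l) (hbc : ¬ Concurrent A b c l)
    (hall : ∀ i, Concurrent A l a i ∨ Concurrent A l b i ∨ Concurrent A l c i) :
    IrreducibleSpace (Moduli A) := by
  classical
  -- The prescribed pair is (0,0) for `l` itself, and (1,0), (0,1) or (1,1) according to whether the
  -- line meets `l` on `a`, `b` or `c`.
  refine irreducibleSpace_moduli hA
    (fun i => if i = l then 0 else if Concurrent A l a i then 1 else
      if Concurrent A l b i then 0 else 1)
    (fun i => if i = l then 0 else if Concurrent A l a i then 0 else 1) fun B => ?_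
  have hc := B.2.concurrent_iff hA
  have hinj := B.2.injective hA
  obtain ⟨s, hs, ha, hb, hl⟩ := exists_normal_frame ((hc a b l).not.2 hab)
  have hx : s c 0 ≠ 0 := fun h0 => (hc b c l).not.2 hbc <| by
    rw [hs.concurrent_iff, hb, hl, tri_eq]; simp [h0]
  have hy : s c 1 ≠ 0 := fun h0 => (hc a c l).not.2 hac <| by
    rw [hs.concurrent_iff, ha, hl, tri_eq]; simp [h0]
  have hN := hs.scale hx hy one_ne_zero
  have hne : ∀ i, i ≠ l → s i 0 = 0 → s i 1 = 0 → False := by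
    intro i hi h0 h1
    refine hi (hinj ((hs.eq_iff i l).2 ?_))
    rw [hl]
    ext t
    fin_cases t <;> simp [cross_apply, h0, h1]
  have key : ∀ i, ∃ h k : ℂ, k ≠ 0 ∧ ![s i 0 / s c 0, s i 1 / s c 1, s i 2 / 1] = k •
      ![if i = l then 0 else if Concurrent A l a i then 1 else if Concurrent A l b i then 0 else 1,
        if i = l then 0 else if Concurrent A l a i then 0 else 1, h] := by
    intro i
    by_cases hi : i = l
    · subst hi
      exact ⟨1, 1, one_ne_zero, by simp [hl]⟩
    have h1 : Concurrent A l a i → s i 1 = 0 := by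
      rw [← hc, hs.concurrent_iff, ha, hl, tri_eq]; simp
    have h2 : Concurrent A l b i → s i 0 = 0 := by
      rw [← hc, hs.concurrent_iff, hb, hl, tri_eq]; simp
    have h3 : Concurrent A l c i → s i 0 / s c 0 = s i 1 / s c 1 := by
      rw [← hc, hs.concurrent_iff, hl, tri_eq, div_eq_div_iff hx hy]
      simp only [Matrix.cons_val]
      intro h; linear_combination -h
    simp only [if_neg hi]
    by_cases hia : Concurrent A l a i
    · have h0 : s i 0 / s c 0 ≠ 0 := div_ne_zero (fun h0 => hne i hi h0 (h1 hia)) hx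
      refine ⟨s i 2 / (s i 0 / s c 0), _, h0, ?_⟩
      simp [hia, h1 hia, mul_div_cancel₀ _ h0]
    have h0 : s i 1 / s c 1 ≠ 0 := by
      refine div_ne_zero (fun h0 => ?_) hy
      refine hia ?_
      rw [← hc, hs.concurrent_iff, ha, hl, tri_eq]; simp [h0]
    refine ⟨s i 2 / (s i 1 / s c 1), _, h0, ?_⟩
    by_cases hib : Concurrent A l b i
    · simp [hia, hib, h2 hib, mul_div_cancel₀ _ h0]
    · have hic : Concurrent A l c i := by have := hall i; tauto
      simp [hia, hib, h3 hic, mul_div_cancel₀ _ h0]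
  choose h k hk hk' using key
  exact ⟨h, hN.rescale fun i => ⟨k i, hk i, hk' i⟩⟩

/-! ### Counting lines through the quadruple points. -/

section Incidence

variable {n : ℕ} {A : Fin n → Line}

open Classical in
/-- The labels of the lines through a point. -/
noncomputable def through (A : Fin n → Line) (p : Plane) : Finset (Fin n) :=
  {i | p ∈ points (A i)}

theorem mem_through {p : Plane} {i : Fin n} : i ∈ through A p ↔ p ∈ points (A i) := by
  simp [through]

theorem card_through (p : Plane) : (through A p).card = mult A p := by
  rw [mult, ← Set.ncard_coe_finset]
  congr 1
  ext i
  simp [mem_through]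

theorem eq_of_mem_through (hA : Function.Injective A) {p q : Plane} {i j : Fin n} (hpq : p ≠ q)
    (hpi : i ∈ through A p) (hqi : i ∈ through A q) (hpj : j ∈ through A p)
    (hqj : j ∈ through A q) : i = j := by
  rw [mem_through] at *
  by_contra hij
  exact hpq (eq_of_mem_points (hA.ne hij) hpi hpj hqi hqj)

theorem card_through_inter_le_one (hA : Function.Injective A) {p q : Plane} (hpq : p ≠ q) :
    (through A p ∩ through A q).card ≤ 1 := by
  rw [Finset.card_le_one]
  intro i hi j hj
  rw [Finset.mem_inter] at hi hj
  exact eq_of_mem_through hA hpq hi.1 hi.2 hj.1 hj.2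

/-- Every line contains, besides any two given points, another point on two more lines. -/
def HasThirdPoints (A : Fin n → Line) : Prop :=
  ∀ (i : Fin n) (X Y : Plane), ∃ Z, Z ≠ X ∧ Z ≠ Y ∧ i ∈ through A Z ∧
    ∃ x ∈ through A Z, ∃ y ∈ through A Z, x ≠ i ∧ y ≠ i ∧ x ≠ y

theorem NonReductive.hasThirdPoints (h : NonReductive A) : HasThirdPoints A := by
  intro i X Y
  have h1 : ¬ {p | p ∈ points (A i) ∧ 3 ≤ mult A p} ⊆ {X, Y} := by
    intro hsub
    have h2 := (h i).trans ((Set.encard_le_encard hsub).trans (Set.encard_insert_le _ _))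
    rw [Set.encard_singleton] at h2
    exact absurd h2 (by decide)
  obtain ⟨Z, ⟨hZ, hm⟩, hXY⟩ := Set.not_subset.1 h1
  rw [← card_through] at hm
  have hi : i ∈ through A Z := mem_through.2 hZ
  have h3 : 1 < ((through A Z).erase i).card := by rw [Finset.card_erase_of_mem hi]; omega
  obtain ⟨x, hx, y, hy, hxy⟩ := Finset.one_lt_card.1 h3
  rw [Finset.mem_erase] at hx hy
  simp only [Set.mem_insert_iff, Set.mem_singleton_iff, not_or] at hXY
  exact ⟨Z, hXY.1, hXY.2, hi, x, hx.2, y, hy.2, hx.1, hy.1, hxy⟩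

theorem HasThirdPoints.comp (h : HasThirdPoints A) (e : Fin n ≃ Fin n) :
    HasThirdPoints (A ∘ e) := by
  intro i X Y
  obtain ⟨Z, h1, h2, h3, x, hx, y, hy, h4, h5, h6⟩ := h (e i) X Y
  refine ⟨Z, h1, h2, mem_through.2 ((mem_through (A := A)).1 h3), e.symm x, ?_, e.symm y, ?_, ?_, ?_, ?_⟩
  · simpa [mem_through] using hx
  · simpa [mem_through] using hy
  · rwa [ne_eq, Equiv.symm_apply_eq]
  · rwa [ne_eq, Equiv.symm_apply_eq]
  · simpa using h6

/-- Inclusion–exclusion gives 12 minus the number of lines through R that also pass through P or Q.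
By `hQR` these all join P and R, so there is at most one. -/
theorem card_union_through (hA : Function.Injective A) {P Q R : Plane} (hP : mult A P = 4)
    (hQ : mult A Q = 4) (hR : mult A R = 4) (hPR : P ≠ R)
    (hQR : through A Q ∩ through A R ⊆ through A P) :
    11 ≤ (through A P ∪ through A Q ∪ through A R).card + (through A P ∩ through A Q).card := by
  have h1 := Finset.card_union_add_card_inter (through A P) (through A Q)
  have h2 := Finset.card_union_add_card_inter (through A P ∪ through A Q) (through A R)
  have h3 : (through A P ∪ through A Q) ∩ through A R ⊆ through A P ∩ through A R := by
    intro i hi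
    have := @hQR i
    simp only [Finset.mem_inter, Finset.mem_union] at *
    tauto
  have h4 := (Finset.card_le_card h3).trans (card_through_inter_le_one hA hPR)
  simp only [card_through] at h1 h2
  omega

end Incidence

theorem irreducibleSpace_moduli_of_common_line {A : Fin 10 → Line} (hA : Function.Injective A)
    {P Q R : Plane} (hP : mult A P = 4) (hQ : mult A Q = 4) (hR : mult A R = 4) (hPQ : P ≠ Q)
    (hPR : P ≠ R) (hQR : Q ≠ R) {l : Fin 10} (hlP : l ∈ through A P) (hlQ : l ∈ through A Q)
    (hlR : l ∈ through A R) : IrreducibleSpace (Moduli A) := by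
  have hex : ∀ p, mult A p = 4 → ∃ a ∈ through A p, a ≠ l := by
    intro p hp
    refine Finset.exists_mem_ne ?_ l
    rw [card_through, hp]; norm_num
  obtain ⟨a, haP, hal⟩ := hex P hP
  obtain ⟨b, hbQ, hbl⟩ := hex Q hQ
  obtain ⟨c, hcR, hcl⟩ := hex R hR
  have hnot : ∀ {p q : Plane} {i j : Fin 10}, p ≠ q → i ∈ through A p → j ∈ through A q →
      l ∈ through A p → l ∈ through A q → i ≠ l → j ≠ l → ¬ Concurrent A i j l := by
    intro p q i j hpq hi hj hp hq hil hjl h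
    have hj' := h.rotate.rotate.mem (hA.ne hil.symm) (mem_through.1 hp) (mem_through.1 hi)
    exact hjl (eq_of_mem_through hA hpq (mem_through.2 hj') hj hp hq)
  refine irreducibleSpace_moduli_of_collinear hA (hnot hPQ haP hbQ hlP hlQ hal hbl)
    (hnot hPR haP hcR hlP hlR hal hcl) (hnot hQR hbQ hcR hlQ hlR hbl hcl) fun i => ?_
  -- Since P and Q share at most one line, the bound 11 forces the union to be all 10 lines.
  have hcard := card_union_through hA hP hQ hR hPR fun j hj => by
    rw [Finset.mem_inter] at hj
    rwa [← eq_of_mem_through hA hQR hlQ hlR hj.1 hj.2]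
  have h1 := card_through_inter_le_one hA hPQ
  have huniv : through A P ∪ through A Q ∪ through A R = Finset.univ := by
    rw [← Finset.card_eq_iff_eq_univ, Fintype.card_fin]
    have := Finset.card_le_univ (through A P ∪ through A Q ∪ through A R)
    rw [Fintype.card_fin] at this
    omega
  have hi := Finset.mem_univ i
  rw [← huniv, Finset.mem_union, Finset.mem_union] at hi
  rw [mem_through] at *
  simp only [mem_through] at hi
  rcases hi with (hi | hi) | hi
  · exact .inl (concurrent_of_mem hlP haP hi)
  · exact .inr (.inl (concurrent_of_mem hlQ hbQ hi))
  · exact .inr (.inr (concurrent_of_mem hlR hcR hi))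

/-! ### The triangular configuration and its normal form. -/

/-- The sides of a triangle (`0`, `1`, `2`), a transversal `3` in general position to them, and two
more lines through each vertex, the first of which passes through the intersection of the
transversal and the opposite side. -/
structure IsGrid (B : Fin 10 → Line) : Prop where
  injective : Function.Injective B
  sides : ¬ Concurrent B 0 1 2
  transversal₀ : ¬ Concurrent B 1 2 3
  transversal₁ : ¬ Concurrent B 0 2 3
  transversal₂ : ¬ Concurrent B 0 1 3
  vertex₄ : Concurrent B 1 2 4
  vertex₅ : Concurrent B 1 2 5
  vertex₆ : Concurrent B 0 2 6
  vertex₇ : Concurrent B 0 2 7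
  vertex₈ : Concurrent B 0 1 8
  vertex₉ : Concurrent B 0 1 9
  opposite₄ : Concurrent B 0 3 4
  opposite₆ : Concurrent B 1 3 6
  opposite₈ : Concurrent B 2 3 8

/-- The normal form of the coordinate vectors of a grid. -/
def gridVec (a b c : ℂ) : Fin 10 → Fin 3 → ℂ :=
  ![![1, 0, 0], ![0, 1, 0], ![0, 0, 1], ![1, 1, 1], ![0, 1, 1], ![0, 1, a], ![1, 0, 1],
    ![b, 0, 1], ![1, 1, 0], ![1, c, 0]]

theorem IsGrid.congr {B C : Fin 10 → Line} (hB : IsGrid B) (hC : Function.Injective C)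
    (h : ∀ i j k, Concurrent C i j k ↔ Concurrent B i j k) : IsGrid C := by
  obtain ⟨-, h1, h2, h3, h4, h5, h6, h7, h8, h9, h10, h11, h12, h13⟩ := hB
  constructor <;> first | exact hC | (rw [h]; assumption)

theorem IsGrid.exists_normal {B : Fin 10 → Line} (hB : IsGrid B) :
    ∃ a b c, Normal B (gridVec a b c) := by
  obtain ⟨s, hs, h0, h1, h2⟩ := exists_normal_frame hB.sides
  have hx : s 3 0 ≠ 0 := by
    have := hB.transversal₀
    rw [hs.concurrent_iff, h1, h2, tri_eq] at this
    simpa using this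
  have hy : s 3 1 ≠ 0 := by
    have := hB.transversal₁
    rw [hs.concurrent_iff, h0, h2, tri_eq] at this
    simpa using this
  have hz : s 3 2 ≠ 0 := by
    have := hB.transversal₂
    rw [hs.concurrent_iff, h0, h1, tri_eq] at this
    simpa using this
  obtain ⟨t, ht, h0', h1', h2', h3'⟩ : ∃ t : Fin 10 → Fin 3 → ℂ, Normal B t ∧
      t 0 = ![1 / s 3 0, 0, 0] ∧ t 1 = ![0, 1 / s 3 1, 0] ∧ t 2 = ![0, 0, 1 / s 3 2] ∧
      t 3 = ![1, 1, 1] :=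
    ⟨_, hs.scale hx hy hz, by simp [h0], by simp [h1], by simp [h2], by simp [hx, hy, hz]⟩
  have hne : ∀ i j, i ≠ j → t i ⨯₃ t j ≠ 0 := fun i j hij =>
    (ht.eq_iff i j).not.1 (hB.injective.ne hij)
  have hv4 := hB.vertex₄
  have hv5 := hB.vertex₅
  have hv6 := hB.vertex₆
  have hv7 := hB.vertex₇
  have hv8 := hB.vertex₈
  have hv9 := hB.vertex₉
  have ho4 := hB.opposite₄
  have ho6 := hB.opposite₆
  have ho8 := hB.opposite₈
  simp only [ht.concurrent_iff, h0', h1', h2', h3', tri_eq] at hv4 hv5 hv6 hv7 hv8 hv9 ho4 ho6 ho8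
  simp [hx, hy, hz, sub_eq_zero] at hv4 hv5 hv6 hv7 hv8 hv9 ho4 ho6 ho8
  have h4 : t 4 2 ≠ 0 := fun h => ht.ne_zero 4 (by ext c; fin_cases c <;> simp [hv4, ← ho4, h])
  have h6 : t 6 2 ≠ 0 := fun h => ht.ne_zero 6 (by ext c; fin_cases c <;> simp [hv6, ho6, h])
  have h8 : t 8 1 ≠ 0 := fun h => ht.ne_zero 8 (by ext c; fin_cases c <;> simp [hv8, ← ho8, h])
  have h5 : t 5 1 ≠ 0 := fun h => hne 5 2 (by decide) (by
    ext c; fin_cases c <;> simp [cross_apply, hv5, h, h2'])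
  have h7 : t 7 2 ≠ 0 := fun h => hne 7 0 (by decide) (by
    ext c; fin_cases c <;> simp [cross_apply, hv7, h, h0'])
  have h9 : t 9 0 ≠ 0 := fun h => hne 9 1 (by decide) (by
    ext c; fin_cases c <;> simp [cross_apply, hv9, h, h1'])
  refine ⟨t 5 2 / t 5 1, t 7 0 / t 7 2, t 9 1 / t 9 0, ht.rescale fun i => ?_⟩
  fin_cases i
  · exact ⟨_, one_div_ne_zero hx, by simp [h0', gridVec]⟩
  · exact ⟨_, one_div_ne_zero hy, by simp [h1', gridVec]⟩
  · exact ⟨_, one_div_ne_zero hz, by simp [h2', gridVec]⟩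
  · exact ⟨1, one_ne_zero, by simp [h3', gridVec]⟩
  · exact ⟨_, h4, by ext c; fin_cases c <;> simp [hv4, ho4, gridVec]⟩
  · exact ⟨_, h5, by ext c; fin_cases c <;> simp [hv5, gridVec]; field_simp⟩
  · exact ⟨_, h6, by ext c; fin_cases c <;> simp [hv6, ho6, gridVec]⟩
  · exact ⟨_, h7, by ext c; fin_cases c <;> simp [hv7, gridVec]; field_simp⟩
  · exact ⟨_, h8, by ext c; fin_cases c <;> simp [hv8, ho8, gridVec]⟩
  · exact ⟨_, h9, by ext c; fin_cases c <;> simp [hv9, gridVec]; field_simp⟩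

/-- The cyclic symmetry of the labels of a grid. -/
def gridRotate : Fin 10 ≃ Fin 10 where
  toFun := ![1, 2, 0, 3, 6, 7, 8, 9, 4, 5]
  invFun := ![2, 0, 1, 3, 8, 9, 4, 5, 6, 7]
  left_inv := by decide
  right_inv := by decide

/-- Realized by a cyclic permutation of coordinates. It transports every condition found at one
vertex to the other two. -/
theorem Normal.gridRotate {B : Fin 10 → Line} {a b c : ℂ} (h : Normal B (gridVec a b c)) :
    Normal (B ∘ gridRotate) (gridVec b c a) := by
  obtain ⟨M, hM, hs⟩ := h
  let N : Matrix (Fin 3) (Fin 3) ℂ := Matrix.of ![![0, 1, 0], ![0, 0, 1], ![1, 0, 0]]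
  have hN : N.det ≠ 0 := by simp [N, Matrix.det_fin_three]
  refine ⟨N * M, by rw [Matrix.det_mul]; exact mul_ne_zero hN hM, fun i => ?_⟩
  obtain ⟨k, hk, hki⟩ := hs (LineArr.gridRotate i)
  refine ⟨k, hk, ?_⟩
  rw [← Matrix.mulVec_mulVec, Function.comp_apply, hki, Matrix.mulVec_smul]
  congr 1
  fin_cases i <;> ext c <;> fin_cases c <;>
    simp [N, LineArr.gridRotate, gridVec, Matrix.mulVec, dotProduct, Fin.sum_univ_three]

/-! ### Equations for the three parameters. -/

section Parameters

variable {B : Fin 10 → Line} {a b c : ℂ}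

theorem gridVec_ne (hB : Function.Injective B) (h : Normal B (gridVec a b c)) : a ≠ 0 ∧ a ≠ 1 := by
  constructor
  · rintro rfl
    exact (by decide : (5 : Fin 10) ≠ 1) (hB ((h.eq_iff 5 1).2 (by simp [gridVec])))
  · rintro rfl
    exact (by decide : (5 : Fin 10) ≠ 4) (hB ((h.eq_iff 5 4).2 (by simp [gridVec])))

theorem HasThirdPoints.exists_off_lines {n : ℕ} {B : Fin n → Line} (hB : Function.Injective B)
    (hm : HasThirdPoints B) {i j k : Fin n} (hj : j ≠ i) (hk : k ≠ i) :
    ∃ Z, j ∉ through B Z ∧ k ∉ through B Z ∧ i ∈ through B Z ∧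
      ∃ x ∈ through B Z, ∃ y ∈ through B Z, x ≠ i ∧ y ≠ i ∧ x ≠ y := by
  obtain ⟨X, hXi, hXj⟩ := exists_mem_points (B i) (B j)
  obtain ⟨Y, hYi, hYk⟩ := exists_mem_points (B i) (B k)
  obtain ⟨Z, hZX, hZY, hZi, h⟩ := hm i X Y
  refine ⟨Z, fun hZj => ?_, fun hZk => ?_, hZi, h⟩
  · exact hj (eq_of_mem_through hB hZX hZj (mem_through.2 hXj) hZi (mem_through.2 hXi))
  · exact hk (eq_of_mem_through hB hZY hZk (mem_through.2 hYk) hZi (mem_through.2 hYi))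

theorem gridVec_first (hB : Function.Injective B) (hm : HasThirdPoints B)
    (h : Normal B (gridVec a b c)) : c = -1 ∨ b = -1 ∨ b * c = -1 := by
  obtain ⟨-, ha1⟩ := gridVec_ne hB h
  obtain ⟨hb0, hb1⟩ := gridVec_ne (hB.comp gridRotate.injective) h.gridRotate
  obtain ⟨hc0, hc1⟩ := gridVec_ne ((hB.comp gridRotate.injective).comp gridRotate.injective)
    h.gridRotate.gridRotate
  obtain ⟨Z, hZ1, hZ0, hZ4, x, hx, y, hy, hx4, hy4, hxy⟩ :=
    hm.exists_off_lines hB (i := 4) (j := 1) (k := 0) (by decide) (by decide)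
  obtain ⟨z, -, hz⟩ := h.exists_vector Z
  simp only [mem_through, hz] at hZ1 hZ0 hZ4 hx hy
  simp [gridVec, dotProduct, Fin.sum_univ_three] at hZ0 hZ1 hZ4
  have key : ∀ x, z ⬝ᵥ gridVec a b c x = 0 → x ≠ 4 → (x = 6 ∧ z 0 + z 2 = 0) ∨
      (x = 7 ∧ z 0 * b + z 2 = 0) ∨ (x = 8 ∧ z 0 + z 1 = 0) ∨ (x = 9 ∧ z 0 + z 1 * c = 0) := by
    intro x hx hx4
    fin_cases x <;> simp [gridVec, dotProduct, Fin.sum_univ_three] at hx hx4 ⊢ <;> grind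
  have hx' := key x hx hx4
  have hy' := key y hy hy4
  clear key hx hy hz
  rcases hx' with ⟨rfl, hx⟩ | ⟨rfl, hx⟩ | ⟨rfl, hx⟩ | ⟨rfl, hx⟩ <;>
    rcases hy' with ⟨rfl, hy⟩ | ⟨rfl, hy⟩ | ⟨rfl, hy⟩ | ⟨rfl, hy⟩ <;> grind

theorem exists_gridVec_second (hB : Function.Injective B) (hm : HasThirdPoints B)
    (h : Normal B (gridVec a b c)) (X : Plane) : ∃ s : ℂ, ∃ Z : Plane, Z ≠ X ∧
      (∀ i, i ∈ through B Z ↔ ![s, -a, 1] ⬝ᵥ gridVec a b c i = 0) ∧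
      (∃ x ∈ through B Z, x ≠ 5 ∧ 5 ∈ through B Z) ∧
      (s = -1 ∧ (a = -1 ∨ a * c = -1) ∨ s = a ∧ a * b = -1 ∨ s = a * c ∧ a * b * c = -1 ∨
        s = a - 1 ∧ (a * b = b - 1 ∨ a * c = a - 1)) := by
  obtain ⟨ha0, ha1⟩ := gridVec_ne hB h
  obtain ⟨hb0, hb1⟩ := gridVec_ne (hB.comp gridRotate.injective) h.gridRotate
  obtain ⟨hc0, hc1⟩ := gridVec_ne ((hB.comp gridRotate.injective).comp gridRotate.injective)
    h.gridRotate.gridRotate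
  obtain ⟨Y, hY5, hY1⟩ := exists_mem_points (B 5) (B 1)
  obtain ⟨Z, hZX, hZY, hZ5, x, hx, y, hy, hx5, hy5, hxy⟩ := hm 5 X Y
  have hZ1 : 1 ∉ through B Z := fun hZ1 => (by decide : (5 : Fin 10) ≠ 1)
    (eq_of_mem_through hB hZY hZ5 (mem_through.2 hY5) hZ1 (mem_through.2 hY1))
  have hx₀ := hx
  have hZ5' := hZ5
  obtain ⟨z, -, hz⟩ := h.exists_vector Z
  simp only [mem_through, hz] at hZ1 hZ5
  simp [gridVec, dotProduct, Fin.sum_univ_three] at hZ1 hZ5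
  have hz2 : z 2 ≠ 0 := by rintro h0; rw [h0] at hZ5; simp at hZ5; exact hZ1 hZ5
  obtain ⟨s, hs⟩ : ∃ s, z 0 = z 2 * s := ⟨z 0 / z 2, by field_simp⟩
  have hzs : z = z 2 • ![s, -a, 1] := by
    ext t
    fin_cases t
    · simp [hs]
    · simp; linear_combination hZ5
    · simp
  have hthr : ∀ i, i ∈ through B Z ↔ ![s, -a, 1] ⬝ᵥ gridVec a b c i = 0 := by
    intro i
    rw [mem_through, hz, hzs, smul_dotProduct, smul_eq_mul, mul_eq_zero, or_iff_right hz2]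
  refine ⟨s, Z, hZX, hthr, ⟨x, hx₀, hx5, hZ5'⟩, ?_⟩
  rw [hthr] at hx hy
  have key : ∀ x, ![s, -a, 1] ⬝ᵥ gridVec a b c x = 0 → x ≠ 5 → (x = 0 ∧ s = 0) ∨
      (x = 3 ∧ s = a - 1) ∨ (x = 6 ∧ s = -1) ∨ (x = 7 ∧ s * b = -1) ∨ (x = 8 ∧ s = a) ∨
      (x = 9 ∧ s = a * c) := by
    intro x hx hx5
    fin_cases x <;> simp [gridVec, dotProduct, Fin.sum_univ_three] at hx hx5 ⊢ <;> grind
  have hx' := key x hx hx5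
  have hy' := key y hy hy5
  clear key hx hy hz hthr hx₀ hzs hs hZ5' hm hB h
  rcases hx' with ⟨rfl, hx⟩ | ⟨rfl, hx⟩ | ⟨rfl, hx⟩ | ⟨rfl, hx⟩ | ⟨rfl, hx⟩ | ⟨rfl, hx⟩ <;>
    rcases hy' with ⟨rfl, hy⟩ | ⟨rfl, hy⟩ | ⟨rfl, hy⟩ | ⟨rfl, hy⟩ | ⟨rfl, hy⟩ | ⟨rfl, hy⟩ <;>
    grind

theorem gridVec_second (hB : Function.Injective B) (hm : HasThirdPoints B)
    (h : Normal B (gridVec a b c)) : a = -1 ∧ (b * c = 1 ∨ 2 * b = 1 ∨ c = 2) ∨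
      a * b = -1 ∧ a * c = -1 ∨ a * c = -1 ∧ a * b = b - 1 ∨ a * b = -1 ∧ a * c = a - 1 := by
  obtain ⟨ha0, ha1⟩ := gridVec_ne hB h
  obtain ⟨hb0, hb1⟩ := gridVec_ne (hB.comp gridRotate.injective) h.gridRotate
  obtain ⟨hc0, hc1⟩ := gridVec_ne ((hB.comp gridRotate.injective).comp gridRotate.injective)
    h.gridRotate.gridRotate
  -- Any point will do here: the first application only has to avoid the vertex.
  obtain ⟨X, -⟩ := exists_mem_points (B 0) (B 0)
  obtain ⟨s, Z, -, hZ, ⟨x, hx, hx5, hZ5⟩, hs⟩ := exists_gridVec_second hB hm h X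
  obtain ⟨t, Y, hYZ, hY, ⟨-, -, -, hY5⟩, ht⟩ := exists_gridVec_second hB hm h Z
  have hst : s ≠ t := by
    rintro rfl
    exact hx5 (eq_of_mem_through hB hYZ ((hY x).2 ((hZ x).1 hx)) hx hY5 hZ5)
  clear hZ hY hm h
  rcases hs with ⟨rfl, hs | hs⟩ | ⟨rfl, hs⟩ | ⟨rfl, hs⟩ | ⟨rfl, hs | hs⟩ <;>
    rcases ht with ⟨rfl, ht | ht⟩ | ⟨rfl, ht⟩ | ⟨rfl, ht⟩ | ⟨rfl, ht | ht⟩ <;> grind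

/-- A finite elimination; `h4`, …, `h9` are the conditions contributed by the lines with these
labels. -/
theorem grid_parameters (ha0 : a ≠ 0) (ha1 : a ≠ 1) (hb0 : b ≠ 0) (hb1 : b ≠ 1) (hc0 : c ≠ 0)
    (hc1 : c ≠ 1) (h4 : c = -1 ∨ b = -1 ∨ b * c = -1) (h6 : a = -1 ∨ c = -1 ∨ c * a = -1)
    (h8 : b = -1 ∨ a = -1 ∨ a * b = -1)
    (h5 : a = -1 ∧ (b * c = 1 ∨ 2 * b = 1 ∨ c = 2) ∨
      a * b = -1 ∧ a * c = -1 ∨ a * c = -1 ∧ a * b = b - 1 ∨ a * b = -1 ∧ a * c = a - 1)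
    (h7 : b = -1 ∧ (c * a = 1 ∨ 2 * c = 1 ∨ a = 2) ∨
      b * c = -1 ∧ b * a = -1 ∨ b * a = -1 ∧ b * c = c - 1 ∨ b * c = -1 ∧ b * a = b - 1)
    (h9 : c = -1 ∧ (a * b = 1 ∨ 2 * a = 1 ∨ b = 2) ∨
      c * a = -1 ∧ c * b = -1 ∨ c * b = -1 ∧ c * a = a - 1 ∨ c * a = -1 ∧ c * b = c - 1) :
    (a = -1 ∧ b = -1 ∧ c = -1) ∨ (a * b = -1 ∧ a * c = -1 ∧ b * c = -1) := by
  rcases h5 with ⟨h5, h5'⟩ | ⟨h5, h5'⟩ | ⟨h5, h5'⟩ | ⟨h5, h5'⟩ <;>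
    rcases h7 with ⟨h7, h7'⟩ | ⟨h7, h7'⟩ | ⟨h7, h7'⟩ | ⟨h7, h7'⟩ <;>
    rcases h9 with ⟨h9, h9'⟩ | ⟨h9, h9'⟩ | ⟨h9, h9'⟩ | ⟨h9, h9'⟩ <;> grind

end Parameters

/-! ### Finding the triangle and the transversal. -/

section Labels

variable {A : Fin 10 → Line}

/-- If Q and R were not joined, the count would put every line through P, Q or R and give a line `w`
joining P and Q. At a third multiple point of `w`, the two other lines would both pass through R.
That point would then be R, and `w` would contain all three points. -/
theorem exists_mem_through_inter (hA : Function.Injective A) (hm : HasThirdPoints A)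
    {P Q R : Plane} (hP : mult A P = 4) (hQ : mult A Q = 4) (hR : mult A R = 4) (hPQ : P ≠ Q)
    (hPR : P ≠ R) (hno : ∀ i ∈ through A P, i ∈ through A Q → i ∉ through A R) :
    ∃ u ∈ through A Q, u ∈ through A R := by
  by_contra! hQR
  have hcard := card_union_through hA hP hQ hR hPR fun j hj => by
    rw [Finset.mem_inter] at hj
    exact absurd hj.2 (hQR j hj.1)
  have hle := Finset.card_le_univ (through A P ∪ through A Q ∪ through A R)
  rw [Fintype.card_fin] at hle
  have h1 := card_through_inter_le_one hA hPQ
  have huniv : through A P ∪ through A Q ∪ through A R = Finset.univ := by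
    rw [← Finset.card_eq_iff_eq_univ, Fintype.card_fin]; omega
  obtain ⟨w, hw⟩ : (through A P ∩ through A Q).Nonempty := by
    rw [← Finset.card_pos]; omega
  rw [Finset.mem_inter] at hw
  obtain ⟨Z, hZP, hZQ, hwZ, x, hx, y, hy, hxw, hyw, hxy⟩ := hm w P Q
  have key : ∀ x ∈ through A Z, x ≠ w → x ∈ through A R := by
    intro x hx hxw
    have hmem := Finset.mem_univ x
    rw [← huniv, Finset.mem_union, Finset.mem_union] at hmem
    rcases hmem with (h | h) | h
    · exact absurd (eq_of_mem_through hA hZP hx h hwZ hw.1) hxw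
    · exact absurd (eq_of_mem_through hA hZQ hx h hwZ hw.2) hxw
    · exact h
  by_cases hZR : Z = R
  · exact hno w hw.1 hw.2 (hZR ▸ hwZ)
  · exact hxy (eq_of_mem_through hA hZR hx (key x hx hxw) hy (key y hy hyw))

/-- At a third multiple point of the side `u`, the other lines avoid Q and R, so each is `l` or
passes through P. Two lines through P cannot meet there, so one of them is `l`. -/
theorem exists_opposite (hA : Function.Injective A) (hm : HasThirdPoints A) {P Q R : Plane}
    {u v w l : Fin 10} (huQ : u ∈ through A Q) (huR : u ∈ through A R) (hvR : v ∈ through A R)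
    (hwQ : w ∈ through A Q) (hwP : w ∈ through A P) (huv : u ≠ v) (huw : u ≠ w)
    (hl : ∀ x, x ∉ through A P → x ∉ through A Q → x ∉ through A R → x = l) :
    ∃ p ∈ through A P, p ≠ v ∧ p ≠ w ∧ Concurrent A u l p := by
  obtain ⟨Z, hZQ, hZR, huZ, x, hx, y, hy, hxu, hyu, hxy⟩ := hm u Q R
  have hQ : ∀ x ∈ through A Z, x ≠ u → x ∉ through A Q := fun x hx hxu h =>
    hxu (eq_of_mem_through hA hZQ hx h huZ huQ)
  have hR : ∀ x ∈ through A Z, x ≠ u → x ∉ through A R := fun x hx hxu h =>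
    hxu (eq_of_mem_through hA hZR hx h huZ huR)
  have key : ∀ p ∈ through A Z, p ≠ u → p ∈ through A P → l ∈ through A Z →
      ∃ p ∈ through A P, p ≠ v ∧ p ≠ w ∧ Concurrent A u l p := by
    intro p hp hpu hpP hlZ
    refine ⟨p, hpP, ?_, ?_, concurrent_of_mem (mem_through.1 huZ) (mem_through.1 hlZ)
      (mem_through.1 hp)⟩
    · rintro rfl; exact hR p hp hpu hvR
    · rintro rfl; exact hQ p hp hpu hwQ
  by_cases hxP : x ∈ through A P
  · by_cases hyP : y ∈ through A P
    · by_cases hZP : Z = P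
      · exact absurd hwQ (hQ w (hZP ▸ hwP) huw.symm)
      · exact absurd (eq_of_mem_through hA hZP hx hxP hy hyP) hxy
    · exact key x hx hxu hxP (hl y hyP (hQ y hy hyu) (hR y hy hyu) ▸ hy)
  · have hxl := hl x hxP (hQ x hx hxu) (hR x hx hxu)
    by_cases hyP : y ∈ through A P
    · exact key y hy hyu hyP (hxl ▸ hx)
    · exact absurd (hxl.trans (hl y hyP (hQ y hy hyu) (hR y hy hyu)).symm) hxy

theorem exists_fourth {P : Plane} (hP : mult A P = 4) (v w p : Fin 10) :
    ∃ p' ∈ through A P, p' ≠ v ∧ p' ≠ w ∧ p' ≠ p := by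
  by_contra! h
  have hsub : through A P ⊆ {v, w, p} := fun x hx => by
    simp only [Finset.mem_insert, Finset.mem_singleton]
    by_contra! hx'
    exact hx'.2.2 (h x hx hx'.1 hx'.2.1)
  have := (Finset.card_le_card hsub).trans Finset.card_le_three
  rw [card_through, hP] at this
  omega

theorem exists_isGrid (hA : Function.Injective A) (hm : HasThirdPoints A) {P Q R : Plane}
    (hP : mult A P = 4) (hQ : mult A Q = 4) (hR : mult A R = 4) (hPQ : P ≠ Q) (hPR : P ≠ R)
    (hQR : Q ≠ R) (hno : ∀ i ∈ through A P, i ∈ through A Q → i ∉ through A R) :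
    ∃ e : Fin 10 ≃ Fin 10, IsGrid (A ∘ e) := by
  obtain ⟨u, huQ, huR⟩ := exists_mem_through_inter hA hm hP hQ hR hPQ hPR hno
  obtain ⟨v, hvP, hvR⟩ := exists_mem_through_inter hA hm hQ hP hR hPQ.symm hQR
    fun i h1 h2 => hno i h2 h1
  obtain ⟨w, hwP, hwQ⟩ := exists_mem_through_inter hA hm hR hP hQ hPR.symm hQR.symm
    fun i h1 h2 h3 => hno i h2 h3 h1
  have hiPQ : ∀ i ∈ through A P, i ∈ through A Q → i = w := fun i h1 h2 =>
    eq_of_mem_through hA hPQ h1 h2 hwP hwQ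
  have hiPR : ∀ i ∈ through A P, i ∈ through A R → i = v := fun i h1 h2 =>
    eq_of_mem_through hA hPR h1 h2 hvP hvR
  have hiQR : ∀ i ∈ through A Q, i ∈ through A R → i = u := fun i h1 h2 =>
    eq_of_mem_through hA hQR h1 h2 huQ huR
  have huP : u ∉ through A P := fun h => hno u h huQ huR
  have hvQ : v ∉ through A Q := fun h => hno v hvP h hvR
  have hwR : w ∉ through A R := hno w hwP hwQ
  have huv : u ≠ v := by rintro rfl; exact huP hvP
  have huw : u ≠ w := by rintro rfl; exact huP hwP
  have hvw : v ≠ w := by rintro rfl; exact hvQ hwQ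
  have hcard : (through A P ∪ through A Q ∪ through A R).card = 9 := by
    have h1 := Finset.card_union_add_card_inter (through A P) (through A Q)
    have h2 := Finset.card_union_add_card_inter (through A P ∪ through A Q) (through A R)
    have h3 : (through A P ∪ through A Q) ∩ through A R = {u, v} := by
      ext i
      simp only [Finset.mem_inter, Finset.mem_union, Finset.mem_insert, Finset.mem_singleton]
      constructor
      · rintro ⟨h | h, h'⟩
        · exact .inr (hiPR i h h')
        · exact .inl (hiQR i h h')
      · rintro (rfl | rfl)
        · exact ⟨.inr huQ, huR⟩
        · exact ⟨.inl hvP, hvR⟩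
    have h4 : through A P ∩ through A Q = {w} := by
      ext i
      simp only [Finset.mem_inter, Finset.mem_singleton]
      exact ⟨fun h => hiPQ i h.1 h.2, by rintro rfl; exact ⟨hwP, hwQ⟩⟩
    rw [h3, Finset.card_pair huv] at h2
    rw [h4, Finset.card_singleton] at h1
    simp only [card_through] at h1 h2
    omega
  -- The count is 12 - 3 = 9, and the one line left over is the transversal.
  obtain ⟨l, hl⟩ : ∃ l, (through A P ∪ through A Q ∪ through A R)ᶜ = {l} := by
    rw [← Finset.card_eq_one, Finset.card_compl, hcard, Fintype.card_fin]
  have hl' : ∀ x, x ∉ through A P → x ∉ through A Q → x ∉ through A R → x = l := by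
    intro x h1 h2 h3
    rw [← Finset.mem_singleton, ← hl]
    simp [h1, h2, h3]
  have hlmem : l ∉ through A P ∧ l ∉ through A Q ∧ l ∉ through A R := by
    have := Finset.mem_singleton_self l
    rw [← hl] at this
    simpa [and_assoc] using this
  obtain ⟨hlP, hlQ, hlR⟩ := hlmem
  obtain ⟨p, hp, hpv, hpw, hpc⟩ := exists_opposite hA hm huQ huR hvR hwQ hwP huv huw hl'
  obtain ⟨q, hq, hqu, hqw, hqc⟩ := exists_opposite hA hm hvP hvR huR hwP hwQ huv.symm hvw
    fun x h1 h2 h3 => hl' x h2 h1 h3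
  obtain ⟨r, hr, hru, hrv, hrc⟩ := exists_opposite hA hm hwP hwQ huQ hvP hvR huw.symm hvw.symm
    fun x h1 h2 h3 => hl' x h2 h3 h1
  obtain ⟨p', hp', hpv', hpw', hpp⟩ := exists_fourth hP v w p
  obtain ⟨q', hq', hqu', hqw', hqq⟩ := exists_fourth hQ u w q
  obtain ⟨r', hr', hru', hrv', hrr⟩ := exists_fourth hR u v r
  have hP' : ∀ x ∈ through A P, x ≠ v → x ≠ w → x ∉ through A Q ∧ x ∉ through A R :=
    fun x hx hv hw => ⟨fun h => hw (hiPQ x hx h), fun h => hv (hiPR x hx h)⟩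
  have hQ' : ∀ x ∈ through A Q, x ≠ u → x ≠ w → x ∉ through A P ∧ x ∉ through A R :=
    fun x hx hu hw => ⟨fun h => hw (hiPQ x h hx), fun h => hu (hiQR x hx h)⟩
  have hR' : ∀ x ∈ through A R, x ≠ u → x ≠ v → x ∉ through A P ∧ x ∉ through A Q :=
    fun x hx hu hv => ⟨fun h => hv (hiPR x h hx), fun h => hu (hiQR x h hx)⟩
  let f : Fin 10 → Fin 10 := ![u, v, w, l, p, p', q, q', r, r']
  have hf : Function.Injective f := by
    rw [← List.nodup_ofFn]
    simp only [f, List.ofFn_succ, List.nodup_cons, List.mem_cons]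
    simp
    have h1 := hP' p hp hpv hpw
    have h2 := hP' p' hp' hpv' hpw'
    have h3 := hQ' q hq hqu hqw
    have h4 := hQ' q' hq' hqu' hqw'
    have h5 := hR' r hr hru hrv
    have h6 := hR' r' hr' hru' hrv'
    clear hP' hQ' hR' hiPQ hiPR hiQR hno hl hl' hcard hm hA f
    and_intros <;> grind
  refine ⟨.ofBijective f (Finite.injective_iff_bijective.1 hf), hA.comp (Equiv.injective _),
    ?_, ?_, ?_, ?_, ?_, ?_, ?_, ?_, ?_, ?_, hpc, hqc, hrc⟩
  all_goals
    simp only [mem_through] at *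
    first
    | exact concurrent_of_mem hvP hwP hp
    | exact concurrent_of_mem hvP hwP hp'
    | exact concurrent_of_mem huQ hwQ hq
    | exact concurrent_of_mem huQ hwQ hq'
    | exact concurrent_of_mem huR hvR hr
    | exact concurrent_of_mem huR hvR hr'
    | intro h
      first
      | exact hwR (h.mem (hA.ne huv) huR hvR)
      | exact hlP (h.mem (hA.ne hvw) hvP hwP)
      | exact hlQ (h.mem (hA.ne huw) huQ hwQ)
      | exact hlR (h.mem (hA.ne huv) huR hvR)

end Labels

/-! ### Complex conjugation and the two parameter solutions. -/

theorem Normal.conj {n : ℕ} {B : Fin n → Line} {s : Fin n → Fin 3 → ℂ} (h : Normal B s) :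
    Normal (fun i => LineArr.conj (B i)) fun i => star (s i) := by
  obtain ⟨M, hM, hs⟩ := h
  refine ⟨M.map (starRingEnd ℂ), ?_, fun i => ?_⟩
  · rw [← RingHom.mapMatrix_apply, ← RingHom.map_det]
    simpa using hM
  · obtain ⟨k, hk, hki⟩ := hs i
    have hrep : ∃ c : ℂ, c ≠ 0 ∧ (LineArr.conj (B i)).rep = c • star (B i).rep := by
      obtain ⟨c, hc⟩ := Projectivization.exists_smul_eq_mk_rep ℂ (star (B i).rep)
        (star_ne_zero.2 (B i).rep_nonzero)
      refine ⟨c, c.ne_zero, ?_⟩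
      rw [← conj_mk _ (B i).rep_nonzero, (B i).mk_rep] at hc
      exact hc.symm
    obtain ⟨c, hc, hci⟩ := hrep
    refine ⟨c * star k, mul_ne_zero hc (star_ne_zero.2 hk), ?_⟩
    have h1 : M.map (starRingEnd ℂ) *ᵥ star (B i).rep = star (M *ᵥ (B i).rep) := by
      ext t
      simp [Matrix.mulVec, dotProduct]
    rw [hci, Matrix.mulVec_smul, h1, hki, star_smul, smul_smul]

theorem irreducibleSpace_of_grid {A : Fin 10 → Line} (hA : Function.Injective A)
    (hm : HasThirdPoints A) {e : Fin 10 ≃ Fin 10} (he : IsGrid (A ∘ e)) :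
    IrreducibleSpace (Moduli A) ∨ IrreducibleSpace (ConjModuli A) := by
  have hconc : ∀ (B : Realization A) i j k,
      Concurrent (B.1 ∘ e) i j k ↔ Concurrent (A ∘ e) i j k :=
    fun B i j k => B.2.concurrent_iff hA (e i) (e j) (e k)
  have hnormal : ∀ B : Realization A, ∃ a b c, Normal (B.1 ∘ e) (gridVec a b c) := fun B =>
    (he.congr ((B.2.injective hA).comp e.injective) (hconc B)).exists_normal
  have hback : ∀ (B : Fin 10 → Line) a b c, Normal (B ∘ e) (gridVec a b c) →
      Normal B fun i => gridVec a b c (e.symm i) := by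
    rintro B a b c ⟨M, hM, hs⟩
    exact ⟨M, hM, fun i => by simpa using hs (e.symm i)⟩
  obtain ⟨a, b, c, hN⟩ := he.exists_normal
  have hi := he.injective
  have hi' := hi.comp gridRotate.injective
  have hi'' := hi'.comp gridRotate.injective
  have hme := hm.comp e
  have hme' := hme.comp gridRotate
  have hme'' := hme'.comp gridRotate
  have hN' := hN.gridRotate
  have hN'' := hN'.gridRotate
  obtain ⟨ha0, ha1⟩ := gridVec_ne hi hN
  obtain ⟨hb0, hb1⟩ := gridVec_ne hi' hN'
  obtain ⟨hc0, hc1⟩ := gridVec_ne hi'' hN''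
  rcases grid_parameters ha0 ha1 hb0 hb1 hc0 hc1 (gridVec_first hi hme hN)
    (gridVec_first hi' hme' hN') (gridVec_first hi'' hme'' hN'') (gridVec_second hi hme hN)
    (gridVec_second hi' hme' hN') (gridVec_second hi'' hme'' hN'') with ⟨ha, hb, hc⟩ | ⟨hab, hac, hbc⟩
  · left
    refine irreducibleSpace_moduli hA (fun i => gridVec (-1) (-1) (-1) (e.symm i) 0)
      (fun i => gridVec (-1) (-1) (-1) (e.symm i) 1) fun B =>
      ⟨fun i => gridVec (-1) (-1) (-1) (e.symm i) 2, ?_⟩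
    obtain ⟨a', b', c', hB⟩ := hnormal B
    -- These three concurrencies are equivalent to the parameters being -1. They hold for `A`, hence
    -- for every realization.
    have h1 := hconc B 5 6 8
    have h2 := hconc B 4 7 8
    have h3 := hconc B 4 6 9
    simp only [hB.concurrent_iff, hN.concurrent_iff, tri_eq, gridVec] at h1 h2 h3
    simp [ha, hb, hc] at h1 h2 h3
    have ha' : a' = -1 := by linear_combination h1
    have hb' : b' = -1 := by linear_combination h2
    have hc' : c' = -1 := by linear_combination h3
    rw [ha', hb', hc'] at hB
    convert hback B.1 _ _ _ hB using 2 with i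
    ext t
    fin_cases t <;> rfl
  · right
    have hnormal' : ∀ B : Realization A, ∃ a, a * a = -1 ∧ Normal (B.1 ∘ e) (gridVec a a a) := by
      intro B
      obtain ⟨a', b', c', hB⟩ := hnormal B
      -- These determinants vanish exactly when the pairwise products of the parameters are -1, so
      -- the equations pass from `A` to `B` and make the parameters equal.
      have h1 := hconc B 5 7 8
      have h2 := hconc B 5 6 9
      have h3 := hconc B 4 7 9
      simp only [hB.concurrent_iff, hN.concurrent_iff, tri_eq, gridVec] at h1 h2 h3
      simp at h1 h2 h3
      have h1' : a' * b' = -1 := by grind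
      have h2' : a' * c' = -1 := by grind
      have h3' : b' * c' = -1 := by grind
      have hb : b' = a' := by grind
      have hc : c' = a' := by grind
      subst hb hc
      exact ⟨_, h1', hB⟩
    have hsub : Subsingleton (ConjModuli A) := by
      refine ⟨fun x y => ?_⟩
      induction x using Quot.ind with | _ x
      induction y using Quot.ind with | _ y
      induction x using Quotient.ind with | _ B
      induction y using Quotient.ind with | _ C
      obtain ⟨a, ha, hB⟩ := hnormal' B
      obtain ⟨a', ha', hC⟩ := hnormal' C
      by_cases haa : a' = a
      · subst haa
        exact congrArg _ (Quotient.sound (Normal.projEquiv (hback _ _ _ _ hB) (hback _ _ _ _ hC)))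
      · refine Quot.sound ?_
        have hneg : a' = -a := by grind
        -- Both `star a` and `a'` are square roots of -1 different from `a`, since `a` cannot be
        -- real.
        have hstar : star a = a' := by
          have h1 : star a * star a = -1 := by rw [← star_mul, ha]; simp
          have h2 : star a ≠ a := by
            intro h
            obtain ⟨x, rfl⟩ := Complex.conj_eq_iff_real.1 h
            have : x * x = -1 := by exact_mod_cast ha
            nlinarith
          grind
        have hBc : Normal (B.conj.1 ∘ e) (gridVec a' a' a') := by
          have hvec : (fun i => star (gridVec a a a i)) = gridVec a' a' a' := by
            funext i
            fin_cases i <;> ext t <;> fin_cases t <;> simp [gridVec, ← hstar]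
          exact hvec ▸ hB.conj
        exact Quotient.sound (Normal.projEquiv (hback _ _ _ _ hBc) (hback _ _ _ _ hC))
    have hne : Nonempty (ConjModuli A) :=
      ⟨Quot.mk _ (Quotient.mk _ (Realization.of A fun _ _ => rfl))⟩
    exact @IrreducibleSpace.mk _ _ inferInstance hne

end LineArr

theorem mainTheorem5 (A : Fin 10 → LineArr.Line) (hdistinct : Function.Injective A)
    (hnr : LineArr.NonReductive A) (h4 : LineArr.numPoints A 4 = 3)
    (h5 : ∀ r : ℕ, 5 ≤ r → LineArr.numPoints A r = 0) :
    IrreducibleSpace (LineArr.Moduli A) ∨ IrreducibleSpace (LineArr.ConjModuli A) := by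
  obtain ⟨P, Q, R, hPQ, hPR, hQR, hS⟩ := Set.encard_eq_three.1 h4
  have hP : LineArr.mult A P = 4 := by
    have : P ∈ {p | LineArr.mult A p = 4} := by rw [hS]; simp
    exact this
  have hQ : LineArr.mult A Q = 4 := by
    have : Q ∈ {p | LineArr.mult A p = 4} := by rw [hS]; simp
    exact this
  have hR : LineArr.mult A R = 4 := by
    have : R ∈ {p | LineArr.mult A p = 4} := by rw [hS]; simp
    exact this
  by_cases hl : ∃ l ∈ LineArr.through A P, l ∈ LineArr.through A Q ∧ l ∈ LineArr.through A R
  · obtain ⟨l, hlP, hlQ, hlR⟩ := hl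
    exact .inl (LineArr.irreducibleSpace_moduli_of_common_line hdistinct hP hQ hR hPQ hPR hQR
      hlP hlQ hlR)
  · push Not at hl
    obtain ⟨e, he⟩ := LineArr.exists_isGrid hdistinct hnr.hasThirdPoints hP hQ hR hPQ hPR hQR hl
    exact LineArr.irreducibleSpace_of_grid hdistinct hnr.hasThirdPoints he
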